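/- Let $p>0$ and $\alpha\in[-\pi/2,\pi/2]$. For $s>0$ let $a_1,a_2,\dots$ be independent random variables with the gamma density $\gamma_{p,s}(a)=\frac{1}{s^p\Gamma(p)}a^{p-1}e^{-a/s}$, $a\ge 0$, and put $$\mathcal A_n(\alpha)=\begin{pmatrix}0&1\\1&a_n e^{i\alpha}\end{pmatrix},\qquad \mathcal M_n(\alpha)=\mathcal A_1(\alpha)\mathcal A_2(\alpha)\cdots\mathcal A_n(\alpha).$$ With $|\cdot|$ the operator norm for the Euclidean norm on $\mathbb C^2$, each $\ln|\mathcal M_n(\alpha)|$ is integrable, and the Lyapunov exponent $$\lambda_{p,s}(\alpha)=\lim_{n\to\infty}\frac1n\,\mathbb E\ln|\mathcal M_n(\alpha)|=\lim_{n\to\infty}\frac1n\ln|\mathcal M_n(\alpha)|\quad\text{almost surely}$$ exists as a real number for every $s>0$. Moreover, there are real numbers $l_1,l_2,\dots$ (depending on $p$ and $\alpha$ only) such that $$\lambda_{p,s}(\alpha)\sim\sum_{n=1}^{\infty}l_n s^n\qquad (s\to0^+),$$ that is, for every $N\ge 0$, $\lambda_{p,s}(\alpha)-\sum_{n=1}^N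 l_n s^n=o(s^N)$ as $s\to0^+$, and $$l_1=\frac{p\cos\alpha}{2},\quad l_2=-\frac{p\cos2\alpha}{8},\quad l_3=-\frac{p(4p^2-13)\cos3\alpha}{192},$$ $$l_4=\frac{p(4p^2-7)\cos4\alpha}{128},\quad l_5=\frac{p(48p^4-920p^2+1187)\cos5\alpha}{20480}.$$ -/

import Mathlib

open Filter Topology MeasureTheory ProbabilityTheory Asymptotics

noncomputable section

namespace GammaProduct

/-- The matrix `[[0, 1], [1, a e^{iα}]]`. -/
def mat (α a : ℝ) : Matrix (Fin 2) (Fin 2) ℂ :=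
  !![0, 1; 1, (a : ℂ) * Complex.exp (Complex.I * (α : ℂ))]

/-- The product of the matrices with parameters `a 0, …, a (n - 1)`, in this order from left to
right. -/
def prodMat (α : ℝ) (a : ℕ → ℝ) : ℕ → Matrix (Fin 2) (Fin 2) ℂ
  | 0 => 1
  | n + 1 => prodMat α a n * mat α (a n)

/-- The operator norm of a matrix acting on `ℂ²` with the standard euclidean norm. -/
def opNorm (M : Matrix (Fin 2) (Fin 2) ℂ) : ℝ :=
  ‖Matrix.toEuclideanCLM (𝕜 := ℂ) M‖

/-- The law of a sequence of independent gamma variables with shape `p` and scale `s`, i.e. with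
density `x ^ (p - 1) * exp (-x / s) / (s ^ p * Γ(p))` on `[0, ∞)`. Mathlib's gamma measure takes
the rate `s⁻¹`. -/
def gammaSeqLaw (p s : ℝ) : Measure (ℕ → ℝ) :=
  Measure.infinitePi fun _ : ℕ => gammaMeasure p s⁻¹

/-- `𝔼 ln |M_n|`. -/
def meanLogNorm (p s α : ℝ) (n : ℕ) : ℝ :=
  ∫ a, Real.log (opNorm (prodMat α a n)) ∂(gammaSeqLaw p s)

/-- The Lyapunov exponent `lim 𝔼 (ln |M_n|) / n`. -/
def lyapunovExponent (p s α : ℝ) : ℝ :=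
  limUnder atTop fun n : ℕ => meanLogNorm p s α n / n

/-- `f s ~ ∑_{n ≥ 1} l n * s ^ n` as `s → 0⁺`, in the sense of Poincaré. -/
def HasAsymptoticSeries (f : ℝ → ℝ) (l : ℕ → ℝ) : Prop :=
  ∀ N : ℕ, (fun s : ℝ => f s - ∑ n ∈ Finset.Icc 1 N, l n * s ^ n) =o[𝓝[>] 0] fun s => s ^ N

end GammaProduct

end

/-! Existence of the exponent is Kingman's theorem. Since `|det| = 1`, the norms are at least one,
so `ln |M_n|` is a nonnegative subadditive process dominated by sums of `log (2 + |a_k|)`. For such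
processes over an i.i.d. sequence, `IsSubadditiveProcess.exists_tendsto` is proved by a covering
argument: an orbit is cut into short blocks of low average, up to rare bad sites.

For the expansion, put `ω = e^{iα}`, so that `Re ω ≥ 0`. Normalise the row vector `(1, 1) M_n` to
`(q, 1 - q)`. A step sends `q` to `(1 - q) / (1 + aω(1 - q))` and multiplies the sum of the entries
by `1 + aω(1 - q)`. The closed disc with diameter `[0, 1]` is invariant, and on it the entry sum of
`M_n` is comparable to the norm. Hence, if `Φ` is bounded on the disc and the mean of `log |1 + aω(1
- q)| + Φ(q') - Φ(q)` is within `ε` of `Λ` for every `q` in the disc, telescoping gives `|λ - Λ| ≤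
ε` (`abs_lyapunovExponent_sub_le`). No invariant measure is needed.

Such a `Φ` is the real part of `∑ t^j φ_j(q)` with `t = sω` and polynomials `φ_j`. The `k`-th moment
of the gamma law is `s^k p(p+1)⋯(p+k-1)`, so the mean of one step expands in powers of `t`, with an
error uniform on the disc. Order `n` of the corrector equation reads `φ_n(1 - q) - φ_n(q) + (terms
from j < n) = c_n`. Its leading operator reaches only polynomials antisymmetric under `q ↦ 1 - q`.
The symmetric obstruction at order `N + 1` is removed by adding to `φ_N` a symmetric polynomial,
which order `N` does not see; this fixes `c_{N+1}` (`exists_extension`). Then `l_n = Re (c_n ω^n)`,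
and explicit polynomials give `c_1, …, c_5`. -/

noncomputable section

namespace GammaProduct

/-! ### Shifts of i.i.d. sequences: zero-one law and averages of local functions. -/

section

/-- The shift by `k` on sequences. -/
def shift (k : ℕ) (a : ℕ → ℝ) : ℕ → ℝ := fun n => a (n + k)

lemma shift_shift (k l : ℕ) (a : ℕ → ℝ) : shift k (shift l a) = shift (k + l) a := by
  funext n; simp [shift, add_assoc]

lemma shift_apply (k n : ℕ) (a : ℕ → ℝ) : shift k a n = a (n + k) := rfl

lemma measurable_shift (k : ℕ) : Measurable (shift k) :=
  measurable_pi_lambda _ fun n => measurable_pi_apply (n + k)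

/-- The law of an i.i.d. sequence with marginal `ν`. -/
abbrev iidLaw (ν : Measure ℝ) : Measure (ℕ → ℝ) := Measure.infinitePi fun _ : ℕ => ν

lemma measurePreserving_shift (ν : Measure ℝ) [IsProbabilityMeasure ν] (k : ℕ) :
    MeasurePreserving (shift k) (iidLaw ν) (iidLaw ν) :=
  ⟨measurable_shift k,
    Measure.map_infinitePi_infinitePi_of_inj (P := fun _ : ℕ => ν) (add_left_injective k)⟩

lemma iIndepFun_coord (ν : Measure ℝ) [IsProbabilityMeasure ν] :
    iIndepFun (fun (i : ℕ) (a : ℕ → ℝ) => a i) (iidLaw ν) :=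
  iIndepFun_infinitePi (P := fun _ : ℕ => ν) (X := fun _ x => x) fun _ => measurable_id

/-- Extension by zero of a finite tuple to a sequence. -/
def extendZero (S : Finset ℕ) (z : S → ℝ) (i : ℕ) : ℝ := if h : i ∈ S then z ⟨i, h⟩ else 0

lemma measurable_extendZero (S : Finset ℕ) : Measurable (extendZero S) := by
  refine measurable_pi_lambda _ fun i => ?_
  by_cases h : i ∈ S
  · simpa [extendZero, h] using measurable_pi_apply _
  · simp [extendZero, h]

lemma indepFun_of_dependsOn (ν : Measure ℝ) [IsProbabilityMeasure ν] {β γ : Type*}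
    [MeasurableSpace β] [MeasurableSpace γ] {Y : (ℕ → ℝ) → β} {Z : (ℕ → ℝ) → γ}
    (hY : Measurable Y) (hZ : Measurable Z) {S T : Finset ℕ} (hST : Disjoint S T)
    (hYS : DependsOn Y S) (hZT : DependsOn Z T) : IndepFun Y Z (iidLaw ν) := by
  have h := (iIndepFun_coord ν).indepFun_finset S T hST fun i => measurable_pi_apply i
  have h' := h.comp (hY.comp (measurable_extendZero S)) (hZ.comp (measurable_extendZero T))
  have eY : (Y ∘ extendZero S) ∘ (fun (a : ℕ → ℝ) (i : S) => a i) = Y := by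
    funext a
    refine hYS fun i hi => ?_
    simp only [extendZero]
    rw [dif_pos (Finset.mem_coe.1 hi)]
  have eZ : (Z ∘ extendZero T) ∘ (fun (a : ℕ → ℝ) (i : T) => a i) = Z := by
    funext a
    refine hZT fun i hi => ?_
    simp only [extendZero]
    rw [dif_pos (Finset.mem_coe.1 hi)]
  rwa [eY, eZ] at h'

/-- An invariant set equals its preimage under every `shift n`, so it is measurable with respect to
the coordinates from `n` on. Thus it is a tail event and Kolmogorov's law applies. -/
lemma measure_eq_zero_or_one_of_shift_invariant (ν : Measure ℝ) [IsProbabilityMeasure ν]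
    {A : Set (ℕ → ℝ)} (hA : MeasurableSet A) (hinv : ∀ a, shift 1 a ∈ A ↔ a ∈ A) :
    iidLaw ν A = 0 ∨ iidLaw ν A = 1 := by
  have hinv' : ∀ k a, shift k a ∈ A ↔ a ∈ A := by
    intro k
    induction k with
    | zero => intro a; rfl
    | succ k ih => intro a; rw [← ih a, ← hinv (shift k a), shift_shift, add_comm]
  refine measure_zero_or_one_of_measurableSet_limsup_atTop
    (s := fun i : ℕ => MeasurableSpace.comap (fun a : ℕ → ℝ => a i) inferInstance)
    (fun n => (measurable_pi_apply n).comap_le)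
    ((iIndepFun_iff_iIndep _ _ _).1 (iIndepFun_coord ν)) ?_
  rw [limsup_eq_iInf_iSup_of_nat, MeasurableSpace.measurableSet_iInf]
  intro n
  have hA' : A = shift n ⁻¹' A := by ext a; exact (hinv' n a).symm
  have hm : @Measurable _ _ (⨆ i, ⨆ (_ : i ≥ n),
      MeasurableSpace.comap (fun a : ℕ → ℝ => a i) inferInstance) _ (shift n) := by
    refine @measurable_pi_lambda _ _ _ (_) _ _ fun k => ?_
    rw [measurable_iff_comap_le]
    exact le_iSup₂_of_le (f := fun (i : ℕ) (_ : i ≥ n) =>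
      MeasurableSpace.comap (fun a : ℕ → ℝ => a i) inferInstance) (k + n) (by omega) le_rfl
  rw [hA']
  exact hm hA

lemma sum_range_mul (F : ℕ → ℝ) (m K : ℕ) :
    ∑ k ∈ Finset.range (m * K), F k
      = ∑ r ∈ Finset.range K, ∑ j ∈ Finset.range m, F (j * K + r) := by
  induction m with
  | zero => simp
  | succ m ih =>
    rw [Nat.succ_mul, Finset.sum_range_add, ih, ← Finset.sum_add_distrib]
    exact Finset.sum_congr rfl fun r _ => (Finset.sum_range_succ _ _).symm

lemma DependsOn.comp_shift {β : Type*} {Y : (ℕ → ℝ) → β} {K : ℕ} (hY : DependsOn Y (Set.Iio K))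
    (m : ℕ) : DependsOn (fun a => Y (shift m a)) (Finset.Ico m (m + K) : Set ℕ) := by
  intro a b h
  refine hY fun i hi => h _ ?_
  simp only [Finset.coe_Ico, Set.mem_Ico, Set.mem_Iio] at hi ⊢
  omega

/-- Translates of `Y` by multiples of `K` read disjoint blocks of coordinates. Splitting the sum by
residues modulo `K` therefore gives `K` i.i.d. sums, each under the strong law. -/
lemma tendsto_sum_shift_div (ν : Measure ℝ) [IsProbabilityMeasure ν] {Y : (ℕ → ℝ) → ℝ}
    (hY : Measurable Y) (hint : Integrable Y (iidLaw ν)) {K : ℕ}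
    (hdep : DependsOn Y (Set.Iio K)) :
    ∀ᵐ a ∂iidLaw ν, Tendsto (fun m : ℕ => (∑ k ∈ Finset.range (m * K), Y (shift k a)) / m) atTop
      (𝓝 (K * ∫ a, Y a ∂iidLaw ν)) := by
  have key : ∀ r, ∀ᵐ a ∂iidLaw ν, Tendsto (fun m : ℕ =>
      (∑ j ∈ Finset.range m, Y (shift (j * K + r) a)) / m) atTop (𝓝 (∫ a, Y a ∂iidLaw ν)) := by
    intro r
    have hid : ∀ k, IdentDistrib (fun a => Y (shift k a)) Y (iidLaw ν) (iidLaw ν) := fun k =>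
      ⟨(hY.comp (measurable_shift k)).aemeasurable, hY.aemeasurable, by
        rw [← (measurePreserving_shift ν k).map_eq]
        conv_lhs => rw [(measurePreserving_shift ν k).map_eq]
        exact (Measure.map_map hY (measurable_shift k)).symm⟩
    have := strong_law_ae_real (μ := iidLaw ν) (fun j a => Y (shift (j * K + r) a))
      ((hid _).integrable_iff.2 hint) ?_ (fun i => (hid _).trans (hid _).symm)
    · rwa [(hid _).integral_eq] at this
    · intro i j hij
      refine indepFun_of_dependsOn ν (hY.comp (measurable_shift _)) (hY.comp (measurable_shift _))
        (S := Finset.Ico (i * K + r) (i * K + r + K)) (T := Finset.Ico (j * K + r) (j * K + r + K))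
        ?_ (DependsOn.comp_shift hdep _) (DependsOn.comp_shift hdep _)
      rw [Finset.disjoint_left]
      intro x hx hx'
      simp only [Finset.mem_Ico] at hx hx'
      rcases lt_or_gt_of_ne hij with h | h
      · have := Nat.mul_le_mul_right K (Nat.succ_le_of_lt h)
        rw [Nat.succ_mul] at this
        omega
      · have := Nat.mul_le_mul_right K (Nat.succ_le_of_lt h)
        rw [Nat.succ_mul] at this
        omega
  filter_upwards [ae_all_iff.2 key] with a ha
  have h := tendsto_finsetSum (Finset.range K) fun r _ => ha r
  simp only [Finset.sum_const, Finset.card_range, nsmul_eq_mul] at h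
  refine h.congr fun m => ?_
  rw [sum_range_mul, Finset.sum_div]

/-- Nonnegativity allows `n` to be rounded up to a multiple of `K`; the at most `K` extra terms are
absorbed by the gap between the mean and `v`. -/
lemma eventually_sum_shift_le (ν : Measure ℝ) [IsProbabilityMeasure ν] {Y : (ℕ → ℝ) → ℝ}
    (hY : Measurable Y) (hint : Integrable Y (iidLaw ν)) (hnn : ∀ a, 0 ≤ Y a) {K : ℕ} (hK : 0 < K)
    (hdep : DependsOn Y (Set.Iio K)) {v : ℝ} (hv : ∫ a, Y a ∂iidLaw ν < v) :
    ∀ᵐ a ∂iidLaw ν, ∀ᶠ n : ℕ in atTop, ∑ k ∈ Finset.range n, Y (shift k a) ≤ n * v := by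
  have hI : 0 ≤ ∫ a, Y a ∂iidLaw ν := integral_nonneg hnn
  set I := ∫ a, Y a ∂iidLaw ν
  have hKR : (0 : ℝ) < K := by exact_mod_cast hK
  filter_upwards [tendsto_sum_shift_div ν hY hint hdep] with a ha
  have h1 : ∀ᶠ m : ℕ in atTop,
      (∑ k ∈ Finset.range (m * K), Y (shift k a)) / m < K * ((I + v) / 2) :=
    ha.eventually_lt_const (by have : I < (I + v) / 2 := by linarith
                               gcongr)
  have h2 : Tendsto (fun n : ℕ => n / K + 1) atTop atTop :=
    (tendsto_add_atTop_nat 1).comp (Nat.tendsto_div_const_atTop hK.ne')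
  have h3 : ∀ᶠ n : ℕ in atTop, K * ((I + v) / 2) ≤ n * ((v - I) / 2) := by
    have : Tendsto (fun n : ℕ => (n : ℝ) * ((v - I) / 2)) atTop atTop :=
      tendsto_natCast_atTop_atTop.atTop_mul_const (by linarith)
    exact this.eventually_ge_atTop _
  filter_upwards [h2.eventually h1, h3] with n hn hn3
  have hpos : (0 : ℝ) < ((n / K + 1 : ℕ) : ℝ) := by positivity
  rw [div_lt_iff₀ hpos] at hn
  have hle : n ≤ (n / K + 1) * K := by
    have := Nat.div_add_mod n K
    have := Nat.mod_lt n hK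
    rw [add_mul, mul_comm]
    omega
  have hle' : (((n / K + 1 : ℕ) : ℝ)) * K ≤ n + K := by
    have : (n / K + 1) * K ≤ n + K := by
      rw [add_mul, one_mul]; gcongr; exact Nat.div_mul_le_self n K
    exact_mod_cast this
  calc ∑ k ∈ Finset.range n, Y (shift k a)
      ≤ ∑ k ∈ Finset.range ((n / K + 1) * K), Y (shift k a) :=
        Finset.sum_le_sum_of_subset_of_nonneg (Finset.range_mono hle) fun _ _ _ => hnn _
    _ ≤ K * ((I + v) / 2) * ((n / K + 1 : ℕ) : ℝ) := hn.le
    _ = ((I + v) / 2) * (((n / K + 1 : ℕ) : ℝ) * K) := by ring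
    _ ≤ ((I + v) / 2) * (n + K) := by gcongr; linarith
    _ ≤ n * v := by linarith

end

/-! ### Kingman's theorem for nonnegative subadditive processes. -/

section

/-- A nonnegative subadditive process over an i.i.d. sequence, `f n` depending on the first `n`
variables only, whose increments are controlled by an integrable function `c` of one variable. -/
structure IsSubadditiveProcess (ν : Measure ℝ) (f : ℕ → (ℕ → ℝ) → ℝ) (c : ℝ → ℝ) : Prop where
  measurable : ∀ n, Measurable (f n)
  dependsOn : ∀ n, DependsOn (f n) (Set.Iio n)
  nonneg : ∀ n a, 0 ≤ f n a
  zero : ∀ a, f 0 a = 0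
  add_le : ∀ m n a, f (m + n) a ≤ f m a + f n (shift m a)
  one_le : ∀ a, f 1 a ≤ c (a 0)
  shift_le : ∀ n a, f n (shift 1 a) ≤ f (n + 1) a + c (a 0)
  measurable_bound : Measurable c
  bound_nonneg : ∀ x, 0 ≤ c x
  integrable_bound : Integrable c ν

namespace IsSubadditiveProcess

variable {ν : Measure ℝ} {f : ℕ → (ℕ → ℝ) → ℝ} {c : ℝ → ℝ}

lemma le_sum (h : IsSubadditiveProcess ν f c) (n : ℕ) (a : ℕ → ℝ) :
    f n a ≤ ∑ k ∈ Finset.range n, c (a k) := by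
  induction n with
  | zero => simp [h.zero]
  | succ n ih =>
    rw [Finset.sum_range_succ]
    refine (h.add_le n 1 a).trans (add_le_add ih ?_)
    simpa [shift] using h.one_le (shift n a)

lemma integrable_coord [IsProbabilityMeasure ν] (h : IsSubadditiveProcess ν f c) (k : ℕ) :
    Integrable (fun a : ℕ → ℝ => c (a k)) (iidLaw ν) :=
  (measurePreserving_eval_infinitePi (fun _ : ℕ => ν) k).integrable_comp_of_integrable
    h.integrable_bound

lemma integral_coord [IsProbabilityMeasure ν] (h : IsSubadditiveProcess ν f c) (k : ℕ) :
    ∫ a : ℕ → ℝ, c (a k) ∂iidLaw ν = ∫ x, c x ∂ν := by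
  have hp := measurePreserving_eval_infinitePi (fun _ : ℕ => ν) k
  conv_rhs => rw [← hp.map_eq]
  rw [integral_map hp.measurable.aemeasurable h.measurable_bound.aestronglyMeasurable]

lemma integrable [IsProbabilityMeasure ν] (h : IsSubadditiveProcess ν f c) (n : ℕ) :
    Integrable (f n) (iidLaw ν) := by
  refine (integrable_finsetSum (Finset.range n) fun k _ => h.integrable_coord k).mono'
    (h.measurable n).aestronglyMeasurable (ae_of_all _ fun a => ?_)
  rw [Real.norm_of_nonneg (h.nonneg n a)]
  exact h.le_sum n a

/-- The sequences along which `f n / n` is infinitely often below a rational smaller than `q`. -/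
def lowSet (f : ℕ → (ℕ → ℝ) → ℝ) (q : ℝ) : Set (ℕ → ℝ) :=
  ⋃ (r : ℚ) (_ : (r : ℝ) < q), ⋂ N : ℕ, ⋃ (n : ℕ) (_ : N ≤ n), {a | f n a ≤ r * n}

lemma mem_lowSet {q : ℝ} {a : ℕ → ℝ} :
    a ∈ lowSet f q ↔ ∃ r : ℚ, (r : ℝ) < q ∧ ∀ N : ℕ, ∃ n, N ≤ n ∧ f n a ≤ r * n := by
  simp [lowSet]

lemma measurableSet_lowSet (h : IsSubadditiveProcess ν f c) (q : ℝ) :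
    MeasurableSet (lowSet f q) :=
  MeasurableSet.iUnion fun _ => MeasurableSet.iUnion fun _ => MeasurableSet.iInter fun _ =>
    MeasurableSet.iUnion fun n => MeasurableSet.iUnion fun _ =>
      measurableSet_le (h.measurable n) measurable_const

/-- A bounded perturbation is paid for by raising the slope from `r` to `r'`. This is why `lowSet`
asks for some rational slope strictly below `q`. -/
lemma exists_le_of_le_add {u v : ℕ → ℝ} {C r r' : ℝ} (hr : r < r')
    (huv : ∀ n, v n ≤ u n + C) (hu : ∀ N : ℕ, ∃ n, N ≤ n ∧ u n ≤ r * n) (N : ℕ) :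
    ∃ n, N ≤ n ∧ v n ≤ r' * n := by
  have : Tendsto (fun n : ℕ => (n : ℝ) * (r' - r)) atTop atTop :=
    tendsto_natCast_atTop_atTop.atTop_mul_const (by linarith)
  obtain ⟨M, hM⟩ := eventually_atTop.1 (this.eventually_ge_atTop C)
  obtain ⟨n, hn, hun⟩ := hu (max N M)
  refine ⟨n, le_trans (le_max_left _ _) hn, ?_⟩
  have := hM n (le_trans (le_max_right _ _) hn)
  have := huv n
  linarith

/-- `f n (shift 1 a)` and `f (n + 1) a` differ by at most `c (a 0)` in either direction, by `add_le`
and `shift_le`. Together with the zero-one law this makes the liminf almost surely constant. -/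
lemma shift_mem_lowSet (h : IsSubadditiveProcess ν f c) (q : ℝ) (a : ℕ → ℝ) :
    shift 1 a ∈ lowSet f q ↔ a ∈ lowSet f q := by
  rw [mem_lowSet, mem_lowSet]
  constructor
  · rintro ⟨r, hr, H⟩
    obtain ⟨r', hr', hr''⟩ := exists_rat_btwn hr
    refine ⟨r', hr'', fun N => ?_⟩
    obtain ⟨n, hn, hle⟩ := exists_le_of_le_add (u := fun n => f n (shift 1 a))
      (v := fun n => f (n + 1) a - r') (C := c (a 0) - r') hr' (fun n => by
        have h1 := h.add_le 1 n a
        have := h.one_le a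
        rw [add_comm 1 n] at h1
        linarith) H N
    refine ⟨n + 1, by omega, ?_⟩
    push_cast
    linarith
  · rintro ⟨r, hr, H⟩
    obtain ⟨r', hr', hr''⟩ := exists_rat_btwn hr
    refine ⟨r', hr'', fun N => ?_⟩
    have H' : ∀ N : ℕ, ∃ n, N ≤ n ∧ f (n + 1) a - r ≤ r * n := by
      intro N
      obtain ⟨n, hn, hle⟩ := H (N + 1)
      obtain ⟨m, rfl⟩ : ∃ m, n = m + 1 := ⟨n - 1, by omega⟩
      refine ⟨m, by omega, ?_⟩
      push_cast at hle
      linarith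
    exact exists_le_of_le_add (u := fun n => f (n + 1) a - r) (v := fun n => f n (shift 1 a))
      (C := c (a 0) + r) hr' (fun n => by have := h.shift_le n a; linarith) H' N

lemma lowSet_zero_or_one [IsProbabilityMeasure ν] (h : IsSubadditiveProcess ν f c) (q : ℝ) :
    iidLaw ν (lowSet f q) = 0 ∨ iidLaw ν (lowSet f q) = 1 :=
  measure_eq_zero_or_one_of_shift_invariant ν (h.measurableSet_lowSet q) (h.shift_mem_lowSet q)

lemma lowSet_mono {q q' : ℝ} (hq : q ≤ q') : lowSet f q ⊆ lowSet f q' := by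
  intro a ha
  rw [mem_lowSet] at ha ⊢
  obtain ⟨r, hr, H⟩ := ha
  exact ⟨r, hr.trans_le hq, H⟩

/-- The almost sure value of `liminf f n / n`. -/
lemma exists_threshold [IsProbabilityMeasure ν] (h : IsSubadditiveProcess ν f c) :
    ∃ L : ℝ, 0 ≤ L ∧ (∀ q, L < q → ∀ᵐ a ∂iidLaw ν, a ∈ lowSet f q) ∧
      ∀ q, q < L → ∀ᵐ a ∂iidLaw ν, a ∉ lowSet f q := by
  set S : Set ℝ := {q | iidLaw ν (lowSet f q) = 1} with hS
  have hlow : ∀ q ∈ S, 0 ≤ q := by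
    intro q hq
    by_contra! hneg
    have : lowSet f q = ∅ := by
      rw [Set.eq_empty_iff_forall_notMem]
      intro a ha
      obtain ⟨r, hr, H⟩ := mem_lowSet.1 ha
      obtain ⟨n, hn, hle⟩ := H 1
      have hn' : (1 : ℝ) ≤ n := by exact_mod_cast hn
      have := h.nonneg n a
      nlinarith
    rw [hS, Set.mem_ofPred_eq, this, measure_empty] at hq
    exact zero_ne_one hq
  have hne : S.Nonempty := by
    set E := ∫ x, c x ∂ν
    obtain ⟨r, hr, -⟩ := exists_rat_btwn (show E < E + 1 by linarith)
    refine ⟨r + 1, ?_⟩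
    have hsl := eventually_sum_shift_le ν (Y := fun a => c (a 0))
      (h.measurable_bound.comp (measurable_pi_apply 0)) (h.integrable_coord 0)
      (fun a => h.bound_nonneg _) (K := 1) one_pos
      (fun a b hab => by simp only [hab 0 (by simp)]) (v := r)
      (by rw [h.integral_coord 0]; exact hr)
    have : ∀ᵐ a ∂iidLaw ν, a ∈ lowSet f (r + 1) := by
      filter_upwards [hsl] with a ha
      rw [mem_lowSet]
      refine ⟨r, by linarith, fun N => ?_⟩
      obtain ⟨n, hn, hNn⟩ := (ha.and (eventually_ge_atTop N)).exists
      refine ⟨n, hNn, (h.le_sum n a).trans ?_⟩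
      simp only [shift, zero_add] at hn
      linarith
    rw [hS, Set.mem_ofPred_eq]
    rwa [← prob_compl_eq_zero_iff (h.measurableSet_lowSet _)]
  have hbdd : BddBelow S := ⟨0, hlow⟩
  refine ⟨sInf S, le_csInf hne hlow, fun q hq => ?_, fun q hq => ?_⟩
  · obtain ⟨q', hq', hlt⟩ := exists_lt_of_csInf_lt hne hq
    have : ∀ᵐ a ∂iidLaw ν, a ∈ lowSet f q' := by
      have hq'' : iidLaw ν (lowSet f q') = 1 := hq'
      exact (prob_compl_eq_zero_iff (h.measurableSet_lowSet _)).2 hq''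
    filter_upwards [this] with a ha using lowSet_mono hlt.le ha
  · rcases h.lowSet_zero_or_one q with h0 | h1
    · exact measure_eq_zero_iff_ae_notMem.1 h0
    · exact absurd (csInf_le hbdd h1) (not_le.2 hq)

/-- The sequences for which no initial block of length at most `K` has average at most `v`. -/
def badSet (f : ℕ → (ℕ → ℝ) → ℝ) (v : ℝ) (K : ℕ) : Set (ℕ → ℝ) :=
  ⋂ (l : ℕ) (_ : 1 ≤ l ∧ l ≤ K), {a | l * v < f l a}

/-- The cost of the first step, counted on `badSet` only. -/
def badCost (f : ℕ → (ℕ → ℝ) → ℝ) (c : ℝ → ℝ) (v : ℝ) (K : ℕ) (a : ℕ → ℝ) : ℝ :=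
  (badSet f v K).indicator (fun a => c (a 0)) a

lemma mem_badSet {v : ℝ} {K : ℕ} {a : ℕ → ℝ} :
    a ∈ badSet f v K ↔ ∀ l : ℕ, 1 ≤ l → l ≤ K → l * v < f l a := by
  simp [badSet]

lemma measurableSet_badSet (h : IsSubadditiveProcess ν f c) (v : ℝ) (K : ℕ) :
    MeasurableSet (badSet f v K) :=
  MeasurableSet.iInter fun l => MeasurableSet.iInter fun _ =>
    measurableSet_lt measurable_const (h.measurable l)

lemma measurable_badCost (h : IsSubadditiveProcess ν f c) (v : ℝ) (K : ℕ) :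
    Measurable (badCost f c v K) :=
  (h.measurable_bound.comp (measurable_pi_apply 0)).indicator (h.measurableSet_badSet v K)

lemma badCost_nonneg (h : IsSubadditiveProcess ν f c) (v : ℝ) (K : ℕ) (a : ℕ → ℝ) :
    0 ≤ badCost f c v K a :=
  Set.indicator_nonneg (fun _ _ => h.bound_nonneg _) _

lemma badCost_le (h : IsSubadditiveProcess ν f c) (v : ℝ) (K : ℕ) (a : ℕ → ℝ) :
    badCost f c v K a ≤ c (a 0) :=
  Set.indicator_le_self' (fun _ _ => h.bound_nonneg _) _

lemma integrable_badCost [IsProbabilityMeasure ν] (h : IsSubadditiveProcess ν f c) (v : ℝ) (K : ℕ) :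
    Integrable (badCost f c v K) (iidLaw ν) :=
  (h.integrable_coord 0).indicator (h.measurableSet_badSet v K)

lemma dependsOn_badCost (h : IsSubadditiveProcess ν f c) (v : ℝ) {K : ℕ} (hK : 0 < K) :
    DependsOn (badCost f c v K) (Set.Iio K) := by
  intro a b hab
  have h0 : a 0 = b 0 := hab 0 hK
  have hl : ∀ l : ℕ, l ≤ K → f l a = f l b := fun l hl =>
    h.dependsOn l fun i hi => hab i (lt_of_lt_of_le hi hl)
  have hmem : a ∈ badSet f v K ↔ b ∈ badSet f v K := by
    rw [mem_badSet, mem_badSet]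
    exact forall_congr' fun l => imp_congr_right fun _ => imp_congr_right fun hlK => by
      rw [hl l hlK]
  by_cases ha : a ∈ badSet f v K
  · simp [badCost, ha, hmem.1 ha, h0]
  · have hb : b ∉ badSet f v K := fun hb => ha (hmem.2 hb)
    simp [badCost, ha, hb]

/-- Covering by blocks of average at most `v` and single bad sites. -/
lemma le_covering (h : IsSubadditiveProcess ν f c) {v : ℝ} (hv : 0 ≤ v) {K : ℕ} (hK : 0 < K)
    (n : ℕ) : ∀ a, f n a ≤ n * v + ∑ k ∈ Finset.range n, badCost f c v K (shift k a)
      + ∑ k ∈ Finset.Ico (n - K) n, c (a k) := by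
  induction n using Nat.strong_induction_on with
  | _ n ih =>
    intro a
    have hB : ∀ m : ℕ, 0 ≤ ∑ k ∈ Finset.range m, badCost f c v K (shift k a) := fun m =>
      Finset.sum_nonneg fun k _ => h.badCost_nonneg v K _
    rcases le_or_gt n K with hnK | hnK
    · rw [Nat.sub_eq_zero_of_le hnK, ← Finset.range_eq_Ico]
      have := h.le_sum n a
      have := hB n
      have : 0 ≤ n * v := by positivity
      linarith
    -- The first block: a single site charged to `badCost` if `a` is bad, otherwise a block of
    -- length at most `K` with average at most `v`. The last `K` sites, where a block might not fit,
    -- are charged to `c`.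
    · obtain ⟨l, hl1, hlK, hl⟩ : ∃ l : ℕ, 1 ≤ l ∧ l ≤ K ∧ f l a ≤ l * v + badCost f c v K a := by
        by_cases ha : a ∈ badSet f v K
        · refine ⟨1, le_rfl, hK, ?_⟩
          have := h.one_le a
          simp only [badCost, ha, Set.indicator_of_mem, Nat.cast_one]
          linarith
        · have ha' := ha
          rw [mem_badSet] at ha'
          push Not at ha'
          obtain ⟨l, h1, h2, h3⟩ := ha'
          exact ⟨l, h1, h2, h3.trans (by simp [badCost, ha])⟩
      have hln : l ≤ n := hlK.trans hnK.le
      have hsub := h.add_le l (n - l) a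
      rw [Nat.add_sub_cancel' hln] at hsub
      have hrec := ih (n - l) (by omega) (shift l a)
      have hcast : ((n - l : ℕ) : ℝ) = n - l := by push_cast [hln]; ring
      rw [hcast] at hrec
      have hsum : badCost f c v K a
          + ∑ k ∈ Finset.range (n - l), badCost f c v K (shift k (shift l a))
          ≤ ∑ k ∈ Finset.range n, badCost f c v K (shift k a) := by
        have e : n = l + (n - l) := by omega
        conv_rhs => rw [e, Finset.sum_range_add]
        refine add_le_add ?_ (le_of_eq (Finset.sum_congr rfl fun k _ => by
          rw [shift_shift, add_comm]))
        exact Finset.single_le_sum (f := fun k => badCost f c v K (shift k a))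
          (fun k _ => h.badCost_nonneg v K _) (Finset.mem_range.2 hl1)
      have htail : ∑ k ∈ Finset.Ico (n - l - K) (n - l), c (shift l a k)
          ≤ ∑ k ∈ Finset.Ico (n - K) n, c (a k) := by
        simp only [shift]
        rw [Finset.sum_Ico_add' (fun k => c (a k)), Nat.sub_add_cancel hln]
        exact Finset.sum_le_sum_of_subset_of_nonneg
          (Finset.Ico_subset_Ico (by omega) le_rfl) fun _ _ _ => h.bound_nonneg _
      linarith

/-- Almost every sequence has some initial block of average at most `v`, so it leaves `badSet f v K`
once `K` exceeds the length of that block. -/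
lemma tendsto_integral_badCost [IsProbabilityMeasure ν] (h : IsSubadditiveProcess ν f c) {v : ℝ}
    (hv : ∀ᵐ a ∂iidLaw ν, a ∈ lowSet f v) :
    Tendsto (fun K => ∫ a, badCost f c v K a ∂iidLaw ν) atTop (𝓝 0) := by
  rw [← integral_zero (ℕ → ℝ) ℝ (μ := iidLaw ν)]
  refine tendsto_integral_of_dominated_convergence (fun a => c (a 0))
    (fun K => (h.measurable_badCost v K).aestronglyMeasurable) (h.integrable_coord 0)
    (fun K => ae_of_all _ fun a => ?_) ?_
  · rw [Real.norm_of_nonneg (h.badCost_nonneg v K a)]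
    exact h.badCost_le v K a
  · filter_upwards [hv] with a ha
    obtain ⟨r, hr, H⟩ := mem_lowSet.1 ha
    obtain ⟨l, hl, hle⟩ := H 1
    refine tendsto_const_nhds.congr' ?_
    filter_upwards [eventually_ge_atTop l] with K hK
    have : a ∉ badSet f v K := fun hb => by
      have h1 := mem_badSet.1 hb l hl hK
      have h2 : (r : ℝ) * l ≤ l * v := by rw [mul_comm]; gcongr
      linarith
    simp [badCost, this]

/-- The covering bound has three parts: blocks cost `n * v`, bad sites have small mean cost for
large `K`, and the last `K` sites are negligible. It serves both the almost sure and the mean upper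
bound. -/
lemma eventually_le [IsProbabilityMeasure ν] (h : IsSubadditiveProcess ν f c) {L : ℝ} (hL : 0 ≤ L)
    (hlow : ∀ q, L < q → ∀ᵐ a ∂iidLaw ν, a ∈ lowSet f q) {q : ℝ} (hq : L < q) :
    (∀ᵐ a ∂iidLaw ν, ∀ᶠ n : ℕ in atTop, f n a ≤ n * q) ∧
      ∀ᶠ n : ℕ in atTop, ∫ a, f n a ∂iidLaw ν ≤ n * q := by
  -- One `ε` each for `v`, for the bad sites, for the upper and the lower estimate of the partial
  -- sums of `c` whose difference is the tail, and for the constant `K * (E - ε)`.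
  set ε := (q - L) / 5 with hε
  have hεpos : 0 < ε := by rw [hε]; linarith
  have hqL : q = L + 5 * ε := by rw [hε]; ring
  set v := L + ε with hv
  have hv0 : 0 ≤ v := by linarith
  obtain ⟨K, hKε, hK⟩ := (((h.tendsto_integral_badCost (hlow v (by linarith))).eventually_lt_const
    hεpos).and (eventually_gt_atTop 0)).exists
  set E := ∫ x, c x ∂ν with hE
  constructor
  · have h1 := eventually_sum_shift_le ν (h.measurable_badCost v K) (h.integrable_badCost v K)
      (h.badCost_nonneg v K) hK (h.dependsOn_badCost v hK) hKε
    have h2 := tendsto_sum_shift_div ν (Y := fun a => c (a 0))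
      (h.measurable_bound.comp (measurable_pi_apply 0)) (h.integrable_coord 0) (K := 1)
      (fun a b hab => by simp only [hab 0 (by simp)])
    rw [h.integral_coord 0] at h2
    filter_upwards [h1, h2] with a ha1 ha2
    simp only [mul_one, Nat.cast_one, one_mul, shift, zero_add] at ha2
    have hup : ∀ᶠ n : ℕ in atTop, ∑ k ∈ Finset.range n, c (a k) ≤ n * (E + ε) := by
      filter_upwards [ha2.eventually_lt_const (show E < E + ε by linarith),
        eventually_gt_atTop 0] with n hn hn0
      rw [div_lt_iff₀ (by exact_mod_cast hn0)] at hn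
      linarith
    have hdown : ∀ᶠ n : ℕ in atTop, n * (E - ε) ≤ ∑ k ∈ Finset.range n, c (a k) := by
      filter_upwards [ha2.eventually_const_lt (show E - ε < E by linarith),
        eventually_gt_atTop 0] with n hn hn0
      rw [lt_div_iff₀ (by exact_mod_cast hn0)] at hn
      linarith
    have hbig : ∀ᶠ n : ℕ in atTop, K * (E - ε) ≤ n * ε :=
      (tendsto_natCast_atTop_atTop.atTop_mul_const hεpos).eventually_ge_atTop _
    filter_upwards [ha1, hup, (tendsto_sub_atTop_nat K).eventually hdown, hbig,
      eventually_ge_atTop K] with n e1 e2 e3 e4 e5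
    have hcov := h.le_covering hv0 hK n a
    rw [Finset.sum_Ico_eq_sub _ (Nat.sub_le n K)] at hcov
    rw [Nat.cast_sub e5] at e3
    rw [hqL]
    rw [hv] at hcov
    linarith
  · have hbig : ∀ᶠ n : ℕ in atTop, K * E ≤ n * ε :=
      (tendsto_natCast_atTop_atTop.atTop_mul_const hεpos).eventually_ge_atTop _
    filter_upwards [hbig] with n hn
    have i1 : ∀ k, Integrable (fun a => badCost f c v K (shift k a)) (iidLaw ν) := fun k =>
      (measurePreserving_shift ν k).integrable_comp_of_integrable (h.integrable_badCost v K)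
    have j1 : ∀ k, ∫ a, badCost f c v K (shift k a) ∂iidLaw ν
        = ∫ a, badCost f c v K a ∂iidLaw ν := fun k => by
      conv_rhs => rw [← (measurePreserving_shift ν k).map_eq]
      rw [integral_map (measurable_shift k).aemeasurable
        (h.measurable_badCost v K).aestronglyMeasurable]
    have i2 := integrable_finsetSum (Finset.range n) fun k _ => i1 k
    have i3 := integrable_finsetSum (Finset.Ico (n - K) n) fun k _ => h.integrable_coord k
    have hE0 : 0 ≤ E := integral_nonneg h.bound_nonneg
    calc ∫ a, f n a ∂iidLaw ν
        ≤ ∫ a, (n * v + ∑ k ∈ Finset.range n, badCost f c v K (shift k a)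
            + ∑ k ∈ Finset.Ico (n - K) n, c (a k)) ∂iidLaw ν :=
          integral_mono (h.integrable n) (((integrable_const _).add i2).add i3)
            fun a => h.le_covering hv0 hK n a
      _ = n * v + n * ∫ a, badCost f c v K a ∂iidLaw ν + ((n - (n - K) : ℕ) : ℝ) * E := by
          have i4 : Integrable (fun a => n * v
              + ∑ k ∈ Finset.range n, badCost f c v K (shift k a)) (iidLaw ν) :=
            (integrable_const _).add i2
          rw [integral_add i4 i3, integral_add (integrable_const _) i2,
            integral_finsetSum _ fun k _ => i1 k,
            integral_finsetSum _ fun k _ => h.integrable_coord k]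
          simp only [j1, h.integral_coord, Finset.sum_const, Finset.card_range, Nat.card_Ico,
            nsmul_eq_mul, integral_const, probReal_univ, smul_eq_mul, one_mul, ← hE]
      _ ≤ n * v + n * ε + K * E := by
          gcongr
          omega
      _ ≤ n * q := by
          have : (0 : ℝ) ≤ n * ε := by positivity
          rw [hqL, hv]
          linarith

/-- Kingman's theorem for nonnegative subadditive processes over an i.i.d. sequence. -/
theorem exists_tendsto [IsProbabilityMeasure ν] (h : IsSubadditiveProcess ν f c) :
    ∃ L : ℝ, (∀ᵐ a ∂iidLaw ν, Tendsto (fun n : ℕ => f n a / n) atTop (𝓝 L)) ∧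
      Tendsto (fun n : ℕ => (∫ a, f n a ∂iidLaw ν) / n) atTop (𝓝 L) := by
  obtain ⟨L, hL, hup, hdown⟩ := h.exists_threshold
  have hae : ∀ᵐ a ∂iidLaw ν, Tendsto (fun n : ℕ => f n a / n) atTop (𝓝 L) := by
    have h1 : ∀ᵐ a ∂iidLaw ν, ∀ m : ℕ, ∀ᶠ n : ℕ in atTop, f n a ≤ n * (L + 1 / (m + 1)) :=
      ae_all_iff.2 fun m => (h.eventually_le hL hup (by
        have : (0 : ℝ) < 1 / (m + 1) := by positivity
        linarith)).1
    have h2 : ∀ᵐ a ∂iidLaw ν, ∀ m : ℕ, a ∉ lowSet f (L - 1 / (m + 1)) :=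
      ae_all_iff.2 fun m => hdown _ (by
        have : (0 : ℝ) < 1 / (m + 1) := by positivity
        linarith)
    filter_upwards [h1, h2] with a ha1 ha2
    rw [tendsto_order]
    refine ⟨fun b hb => ?_, fun b hb => ?_⟩
    · obtain ⟨m, hm⟩ := exists_nat_one_div_lt (show 0 < L - b by linarith)
      obtain ⟨r, hr1, hr2⟩ := exists_rat_btwn (show b < L - 1 / (m + 1) by linarith)
      have := ha2 m
      rw [mem_lowSet] at this
      push Not at this
      obtain ⟨N, hN⟩ := this r hr2
      filter_upwards [eventually_ge_atTop N, eventually_gt_atTop 0] with n hn hn0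
      have hn0' : (0 : ℝ) < n := by exact_mod_cast hn0
      rw [lt_div_iff₀ hn0']
      exact lt_of_le_of_lt (by gcongr) (hN n hn)
    · obtain ⟨m, hm⟩ := exists_nat_one_div_lt (show 0 < b - L by linarith)
      filter_upwards [ha1 m, eventually_gt_atTop 0] with n hn hn0
      have hn0' : (0 : ℝ) < n := by exact_mod_cast hn0
      rw [div_lt_iff₀ hn0', mul_comm b]
      exact lt_of_le_of_lt hn (by gcongr; linarith)
  refine ⟨L, hae, ?_⟩
  have hnn : ∀ n : ℕ, 0 ≤ (∫ a, f n a ∂iidLaw ν) / n := fun n =>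
    div_nonneg (integral_nonneg (h.nonneg n)) (Nat.cast_nonneg n)
  rw [tendsto_order]
  refine ⟨fun b hb => ?_, fun b hb => ?_⟩
  · rcases lt_or_ge b 0 with hb0 | hb0
    · exact Eventually.of_forall fun n => hb0.trans_le (hnn n)
    -- The lower bound for the means is Fatou's lemma applied to the almost sure limit.
    · have hf := lintegral_liminf_le (μ := iidLaw ν) (u := atTop)
        (f := fun (n : ℕ) a => ENNReal.ofReal (f n a / n))
        fun n => ((h.measurable n).div_const _).ennreal_ofReal
      have e1 : ∫⁻ a, liminf (fun n : ℕ => ENNReal.ofReal (f n a / n)) atTop ∂iidLaw ν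
          = ENNReal.ofReal L := by
        rw [lintegral_congr_ae (g := fun _ => ENNReal.ofReal L)]
        · simp
        · filter_upwards [hae] with a ha
          exact (ENNReal.tendsto_ofReal ha).liminf_eq
      have e2 : ∀ n : ℕ, ∫⁻ a, ENNReal.ofReal (f n a / n) ∂iidLaw ν
          = ENNReal.ofReal ((∫ a, f n a ∂iidLaw ν) / n) := fun n => by
        rw [← integral_div, ofReal_integral_eq_lintegral_ofReal ((h.integrable n).div_const _)
          (ae_of_all _ fun a => div_nonneg (h.nonneg n a) (Nat.cast_nonneg n))]
      rw [e1] at hf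
      simp only [e2] at hf
      have hlt : ENNReal.ofReal b < ENNReal.ofReal L :=
        (ENNReal.ofReal_lt_ofReal_iff (hb0.trans_lt hb)).2 hb
      filter_upwards [eventually_lt_of_lt_liminf (hlt.trans_le hf)] with n hn
      exact (ENNReal.ofReal_lt_ofReal_iff_of_nonneg hb0).1 hn
  · filter_upwards [(h.eventually_le hL hup (show L < (L + b) / 2 by linarith)).2,
      eventually_gt_atTop 0] with n hn hn0
    have hn0' : (0 : ℝ) < n := by exact_mod_cast hn0
    rw [div_lt_iff₀ hn0', mul_comm b]
    exact lt_of_le_of_lt hn (by gcongr; linarith)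

end IsSubadditiveProcess

end

/-! ### Moments of the gamma law. -/

section

/-- The rising factorial `p (p + 1) ⋯ (p + k - 1)`. -/
def rising (p : ℝ) (k : ℕ) : ℝ := ∏ i ∈ Finset.range k, (p + i)

lemma rising_zero (p : ℝ) : rising p 0 = 1 := by simp [rising]

lemma rising_succ (p : ℝ) (k : ℕ) : rising p (k + 1) = rising p k * (p + k) := by
  simp [rising, Finset.prod_range_succ]

lemma rising_pos {p : ℝ} (hp : 0 < p) (k : ℕ) : 0 < rising p k :=
  Finset.prod_pos fun i _ => by positivity

lemma Gamma_add_natCast {p : ℝ} (hp : 0 < p) (k : ℕ) :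
    Real.Gamma (p + k) = rising p k * Real.Gamma p := by
  induction k with
  | zero => simp [rising_zero]
  | succ k ih =>
    rw [Nat.cast_succ, ← add_assoc, Real.Gamma_add_one (by positivity), ih, rising_succ]
    ring

/-- Multiplication by `x ^ k` turns the density of shape `p` into a multiple of that of shape `p +
k`, so the moments follow from normalisation alone. -/
lemma gammaPDFReal_mul_pow {p s : ℝ} (hp : 0 < p) (hs : 0 < s) (k : ℕ) {x : ℝ} (hx : x ≠ 0) :
    gammaPDFReal p s⁻¹ x * x ^ k = s ^ k * rising p k * gammaPDFReal (p + k) s⁻¹ x := by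
  rcases lt_or_gt_of_ne hx with h | h
  · simp [gammaPDFReal, not_le.2 h]
  · have hG := (Real.Gamma_pos_of_pos hp).ne'
    have hr := (rising_pos hp k).ne'
    have e : p + k - 1 = (p - 1) + k := by ring
    simp only [gammaPDFReal, if_pos h.le, Gamma_add_natCast hp, e, Real.rpow_add h,
      Real.rpow_add (inv_pos.2 hs), Real.rpow_natCast]
    field_simp
    rw [← mul_pow, mul_one_div_cancel hs.ne', one_pow]

lemma integrable_gammaPDFReal {p r : ℝ} (hp : 0 < p) (hr : 0 < r) :
    Integrable (gammaPDFReal p r) := by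
  refine (lintegral_ofReal_ne_top_iff_integrable
    (measurable_gammaPDFReal p r).aestronglyMeasurable
    (ae_of_all _ (gammaPDFReal_nonneg hp hr))).1 ?_
  have := lintegral_gammaPDF_eq_one hp hr
  simp only [gammaPDF] at this
  simp [this]

lemma integral_gammaPDFReal {p r : ℝ} (hp : 0 < p) (hr : 0 < r) :
    ∫ x, gammaPDFReal p r x = 1 := by
  rw [integral_eq_lintegral_of_nonneg_ae (ae_of_all _ (gammaPDFReal_nonneg hp hr))
    (measurable_gammaPDFReal p r).aestronglyMeasurable]
  have := lintegral_gammaPDF_eq_one hp hr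
  simp only [gammaPDF] at this
  simp [this]

lemma gammaPDF_mul_pow_ae {p s : ℝ} (hp : 0 < p) (hs : 0 < s) (k : ℕ) :
    (fun x => (gammaPDF p s⁻¹ x).toReal • x ^ k)
      =ᵐ[volume] fun x => s ^ k * rising p k * gammaPDFReal (p + k) s⁻¹ x := by
  filter_upwards [Measure.ae_ne volume (0 : ℝ)] with x hx
  rw [gammaPDF, ENNReal.toReal_ofReal (gammaPDFReal_nonneg hp (inv_pos.2 hs) x), smul_eq_mul,
    gammaPDFReal_mul_pow hp hs k hx]

lemma measurable_gammaPDF (p r : ℝ) : Measurable (gammaPDF p r) :=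
  (measurable_gammaPDFReal p r).ennreal_ofReal

lemma integrable_pow_gammaMeasure {p s : ℝ} (hp : 0 < p) (hs : 0 < s) (k : ℕ) :
    Integrable (fun x : ℝ => x ^ k) (gammaMeasure p s⁻¹) := by
  rw [gammaMeasure, integrable_withDensity_iff_integrable_smul' (measurable_gammaPDF _ _)
    (ae_of_all _ fun x => ENNReal.ofReal_lt_top), integrable_congr (gammaPDF_mul_pow_ae hp hs k)]
  exact (integrable_gammaPDFReal (by positivity) (inv_pos.2 hs)).const_mul _

lemma integral_pow_gammaMeasure {p s : ℝ} (hp : 0 < p) (hs : 0 < s) (k : ℕ) :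
    ∫ x, x ^ k ∂gammaMeasure p s⁻¹ = s ^ k * rising p k := by
  rw [gammaMeasure, integral_withDensity_eq_integral_toReal_smul (measurable_gammaPDF _ _)
    (ae_of_all _ fun x => ENNReal.ofReal_lt_top), integral_congr_ae (gammaPDF_mul_pow_ae hp hs k),
    integral_const_mul, integral_gammaPDFReal (by positivity) (inv_pos.2 hs), mul_one]

lemma ae_nonneg_gammaMeasure (p r : ℝ) : ∀ᵐ x ∂gammaMeasure p r, 0 ≤ x := by
  rw [gammaMeasure, ae_withDensity_iff (measurable_gammaPDF p r)]
  refine ae_of_all _ fun x hx => ?_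
  by_contra! h
  exact hx (gammaPDF_of_neg h)

end

/-! ### Norms of the matrix products and existence of the Lyapunov exponent. -/

section

lemma opNorm_nonneg (M : Matrix (Fin 2) (Fin 2) ℂ) : 0 ≤ opNorm M := norm_nonneg _

lemma opNorm_mul_le (M N : Matrix (Fin 2) (Fin 2) ℂ) : opNorm (M * N) ≤ opNorm M * opNorm N := by
  rw [opNorm, map_mul]
  exact norm_mul_le _ _

lemma opNorm_one : opNorm 1 = 1 := by
  rw [opNorm, map_one]
  exact norm_one

lemma continuous_opNorm : Continuous opNorm := by
  have : Continuous (Matrix.toEuclideanCLM (n := Fin 2) (𝕜 := ℂ)) :=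
    LinearMap.continuous_of_finiteDimensional
      (Matrix.toEuclideanCLM (n := Fin 2) (𝕜 := ℂ)).toAlgEquiv.toLinearMap
  exact this.norm

lemma sq_add_sq_le_opNorm (M : Matrix (Fin 2) (Fin 2) ℂ) (x y : ℂ) :
    ‖M 0 0 * x + M 0 1 * y‖ ^ 2 + ‖M 1 0 * x + M 1 1 * y‖ ^ 2
      ≤ opNorm M ^ 2 * (‖x‖ ^ 2 + ‖y‖ ^ 2) := by
  have h := (Matrix.toEuclideanCLM (𝕜 := ℂ) M).le_opNorm (WithLp.toLp 2 ![x, y])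
  have h2 := pow_le_pow_left₀ (norm_nonneg _) h 2
  rw [mul_pow, Matrix.toEuclideanCLM_toLp, EuclideanSpace.norm_sq_eq, EuclideanSpace.norm_sq_eq]
    at h2
  simpa [Fin.sum_univ_two, Matrix.mulVec, dotProduct, opNorm] using h2

lemma opNorm_sq_le (M : Matrix (Fin 2) (Fin 2) ℂ) :
    opNorm M ^ 2 ≤ ‖M 0 0‖ ^ 2 + ‖M 0 1‖ ^ 2 + (‖M 1 0‖ ^ 2 + ‖M 1 1‖ ^ 2) := by
  set B := ‖M 0 0‖ ^ 2 + ‖M 0 1‖ ^ 2 + (‖M 1 0‖ ^ 2 + ‖M 1 1‖ ^ 2) with hB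
  have hB0 : 0 ≤ B := by positivity
  have cs : ∀ a b x y : ℂ, ‖a * x + b * y‖ ^ 2
      ≤ (‖a‖ ^ 2 + ‖b‖ ^ 2) * (‖x‖ ^ 2 + ‖y‖ ^ 2) := by
    intro a b x y
    have h1 : ‖a * x + b * y‖ ≤ ‖a‖ * ‖x‖ + ‖b‖ * ‖y‖ :=
      (norm_add_le _ _).trans (by rw [norm_mul, norm_mul])
    have h2 := pow_le_pow_left₀ (norm_nonneg _) h1 2
    nlinarith [sq_nonneg (‖a‖ * ‖y‖ - ‖b‖ * ‖x‖)]
  have h : opNorm M ≤ Real.sqrt B := by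
    refine ContinuousLinearMap.opNorm_le_bound _ (Real.sqrt_nonneg _) fun v => ?_
    refine le_of_sq_le_sq ?_ (by positivity)
    obtain ⟨v, rfl⟩ := (WithLp.toLp_surjective 2) v
    rw [mul_pow, Real.sq_sqrt hB0, Matrix.toEuclideanCLM_toLp, EuclideanSpace.norm_sq_eq,
      EuclideanSpace.norm_sq_eq]
    simp only [Fin.sum_univ_two, Matrix.mulVec, dotProduct]
    have := cs (M 0 0) (M 0 1) (v 0) (v 1)
    have := cs (M 1 0) (M 1 1) (v 0) (v 1)
    rw [hB]
    linarith
  calc opNorm M ^ 2 ≤ Real.sqrt B ^ 2 := pow_le_pow_left₀ (opNorm_nonneg M) h 2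
    _ = B := Real.sq_sqrt hB0

/-- `1 = |det|` is at most half the sum of the squared entries, and each column has norm at most
`opNorm M`. -/
lemma one_le_opNorm {M : Matrix (Fin 2) (Fin 2) ℂ} (hM : ‖M.det‖ = 1) : 1 ≤ opNorm M := by
  have h1 := sq_add_sq_le_opNorm M 1 0
  have h2 := sq_add_sq_le_opNorm M 0 1
  simp only [mul_one, mul_zero, add_zero, zero_add, norm_one, norm_zero] at h1 h2
  have h3 : 1 ≤ ‖M 0 0‖ * ‖M 1 1‖ + ‖M 0 1‖ * ‖M 1 0‖ := by
    rw [← hM, Matrix.det_fin_two]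
    exact (norm_sub_le _ _).trans (by rw [norm_mul, norm_mul])
  have h4 : 1 ≤ opNorm M ^ 2 := by
    nlinarith [sq_nonneg (‖M 0 0‖ - ‖M 1 1‖), sq_nonneg (‖M 0 1‖ - ‖M 1 0‖)]
  exact (one_le_sq_iff₀ (opNorm_nonneg M)).1 h4

/-- The phase `e^{iα}`. -/
def phase (α : ℝ) : ℂ := Complex.exp (Complex.I * α)

lemma norm_phase (α : ℝ) : ‖phase α‖ = 1 := by
  rw [phase, mul_comm, Complex.norm_exp_ofReal_mul_I]

lemma phase_pow_re (α : ℝ) (n : ℕ) : (phase α ^ n).re = Real.cos (n * α) := by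
  rw [phase, ← Complex.exp_nat_mul, show (n : ℂ) * (Complex.I * α) = ((n * α : ℝ) : ℂ) * Complex.I
    by push_cast; ring, Complex.exp_ofReal_mul_I_re]

lemma phase_re_nonneg {α : ℝ} (hα : α ∈ Set.Icc (-(Real.pi / 2)) (Real.pi / 2)) :
    0 ≤ (phase α).re := by
  have := phase_pow_re α 1
  rw [pow_one] at this
  rw [this]
  simpa using Real.cos_nonneg_of_mem_Icc hα

lemma mat_eq (α x : ℝ) : mat α x = !![0, 1; 1, x * phase α] := rfl

lemma opNorm_mat_le (α x : ℝ) : opNorm (mat α x) ≤ 2 + |x| := by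
  refine le_of_sq_le_sq ?_ (by positivity)
  refine (opNorm_sq_le _).trans ?_
  simp only [mat_eq, Matrix.of_apply, Matrix.cons_val', Matrix.cons_val_zero, Matrix.cons_val_one,
    Matrix.cons_val_fin_one, norm_mul, norm_phase, Complex.norm_real, Real.norm_eq_abs, norm_one,
    norm_zero]
  nlinarith [abs_nonneg x]

/-- The inverse of `mat α x` has entries of the same moduli, hence the same norm bound. This
supplies `shift_le` for the process. -/
lemma opNorm_le_mul_opNorm_mat_mul (α x : ℝ) (M : Matrix (Fin 2) (Fin 2) ℂ) :
    opNorm M ≤ (2 + |x|) * opNorm (mat α x * M) := by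
  set A : Matrix (Fin 2) (Fin 2) ℂ := !![-(x * phase α), 1; 1, 0] with hA
  have h1 : A * mat α x = 1 := by
    rw [hA, mat_eq]
    ext i j
    fin_cases i <;> fin_cases j <;> simp
  have h2 : opNorm A ≤ 2 + |x| := by
    refine le_of_sq_le_sq ?_ (by positivity)
    refine (opNorm_sq_le _).trans ?_
    simp only [hA, Matrix.of_apply, Matrix.cons_val', Matrix.cons_val_zero, Matrix.cons_val_one,
      Matrix.cons_val_fin_one, norm_neg, norm_mul, norm_phase, Complex.norm_real, Real.norm_eq_abs,
      norm_one, norm_zero]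
    nlinarith [abs_nonneg x]
  calc opNorm M = opNorm (A * (mat α x * M)) := by rw [← mul_assoc, h1, one_mul]
    _ ≤ opNorm A * opNorm (mat α x * M) := opNorm_mul_le _ _
    _ ≤ _ := by gcongr; exact opNorm_nonneg _

lemma norm_det_prodMat (α : ℝ) (a : ℕ → ℝ) (n : ℕ) : ‖(prodMat α a n).det‖ = 1 := by
  induction n with
  | zero => simp [prodMat]
  | succ n ih =>
    rw [prodMat, Matrix.det_mul, norm_mul, ih]
    simp [mat, Matrix.det_fin_two]

lemma one_le_opNorm_prodMat (α : ℝ) (a : ℕ → ℝ) (n : ℕ) : 1 ≤ opNorm (prodMat α a n) :=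
  one_le_opNorm (norm_det_prodMat α a n)

lemma prodMat_add (α : ℝ) (a : ℕ → ℝ) (m n : ℕ) :
    prodMat α a (m + n) = prodMat α a m * prodMat α (shift m a) n := by
  induction n with
  | zero => simp [prodMat]
  | succ n ih => rw [← add_assoc, prodMat, ih, prodMat, shift_apply, add_comm n m, mul_assoc]

lemma prodMat_one (α : ℝ) (a : ℕ → ℝ) : prodMat α a 1 = mat α (a 0) := by
  simp [prodMat]

lemma continuous_prodMat (α : ℝ) (n : ℕ) : Continuous fun a => prodMat α a n := by
  induction n with
  | zero => exact continuous_const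
  | succ n ih =>
    refine ih.mul (continuous_matrix fun i j => ?_)
    fin_cases i <;> fin_cases j <;> simp [mat] <;> fun_prop

lemma dependsOn_prodMat (α : ℝ) (n : ℕ) : DependsOn (fun a => prodMat α a n) (Set.Iio n) := by
  intro a b h
  induction n with
  | zero => rfl
  | succ n ih =>
    simp only [prodMat]
    have h1 := ih fun i hi => h i (lt_trans hi (Nat.lt_succ_self n))
    simp only at h1
    rw [h1, h n (Nat.lt_succ_self n)]

lemma isSubadditiveProcess (α : ℝ) {ν : Measure ℝ} (hν : Integrable (fun x : ℝ => x) ν)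
    [IsProbabilityMeasure ν] :
    IsSubadditiveProcess ν (fun n a => Real.log (opNorm (prodMat α a n)))
      fun x => Real.log (2 + |x|) where
  measurable n := Real.measurable_log.comp
    (continuous_opNorm.comp (continuous_prodMat α n)).measurable
  dependsOn n a b h := by
    have := dependsOn_prodMat α n h
    simp only at this
    simp only [this]
  nonneg n a := Real.log_nonneg (one_le_opNorm_prodMat α a n)
  zero a := by simp [prodMat, opNorm_one]
  add_le m n a := by
    rw [← Real.log_mul (by linarith [one_le_opNorm_prodMat α a m])
      (by linarith [one_le_opNorm_prodMat α (shift m a) n]), prodMat_add]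
    refine Real.log_le_log ?_ (opNorm_mul_le _ _)
    rw [← prodMat_add]
    linarith [one_le_opNorm_prodMat α a (m + n)]
  one_le a := by
    refine Real.log_le_log (by linarith [one_le_opNorm_prodMat α a 1]) ?_
    rw [prodMat_one]
    exact opNorm_mat_le α (a 0)
  shift_le n a := by
    have h1 := one_le_opNorm_prodMat α a (n + 1)
    rw [← Real.log_mul (by linarith) (by positivity)]
    refine Real.log_le_log (by linarith [one_le_opNorm_prodMat α (shift 1 a) n]) ?_
    rw [mul_comm, add_comm n 1, prodMat_add, prodMat_one]
    exact opNorm_le_mul_opNorm_mat_mul α (a 0) _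
  measurable_bound := by fun_prop
  bound_nonneg x := Real.log_nonneg (by linarith [abs_nonneg x])
  integrable_bound := by
    refine ((integrable_const (1 : ℝ)).add hν.abs).mono'
      (show Measurable fun x : ℝ => Real.log (2 + |x|) by fun_prop).aestronglyMeasurable
      (ae_of_all _ fun x => ?_)
    rw [Real.norm_of_nonneg (Real.log_nonneg (by linarith [abs_nonneg x]))]
    have := Real.log_le_sub_one_of_pos (show 0 < 2 + |x| by positivity)
    simp only [Pi.add_apply]
    linarith

lemma isSubadditiveProcess_gamma (α : ℝ) {p s : ℝ} (hp : 0 < p) (hs : 0 < s) :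
    IsSubadditiveProcess (gammaMeasure p s⁻¹) (fun n a => Real.log (opNorm (prodMat α a n)))
      fun x => Real.log (2 + |x|) :=
  have := isProbabilityMeasure_gammaMeasure hp (inv_pos.2 hs)
  isSubadditiveProcess α (by simpa using integrable_pow_gammaMeasure hp hs 1)

theorem lyapunovExponent_spec (α : ℝ) {p s : ℝ} (hp : 0 < p) (hs : 0 < s) :
    (∀ n : ℕ, Integrable (fun a => Real.log (opNorm (prodMat α a n))) (gammaSeqLaw p s)) ∧
      Tendsto (fun n : ℕ => meanLogNorm p s α n / n) atTop (𝓝 (lyapunovExponent p s α)) ∧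
      ∀ᵐ a ∂(gammaSeqLaw p s), Tendsto (fun n : ℕ => Real.log (opNorm (prodMat α a n)) / n)
        atTop (𝓝 (lyapunovExponent p s α)) := by
  have := isProbabilityMeasure_gammaMeasure hp (inv_pos.2 hs)
  have h := isSubadditiveProcess_gamma α hp hs
  obtain ⟨L, hae, hmean⟩ := h.exists_tendsto
  have hL : lyapunovExponent p s α = L := hmean.limUnder_eq
  rw [hL]
  exact ⟨h.integrable, hmean, hae⟩

end

/-! ### The invariant disc and the projective action. -/

section

/-- The closed disc with diameter `[0, 1]`. -/
def disc : Set ℂ := {q | ‖q‖ ^ 2 ≤ q.re}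

lemma norm_le_one_of_mem_disc {q : ℂ} (hq : q ∈ disc) : ‖q‖ ≤ 1 := by
  have h1 : ‖q‖ ^ 2 ≤ q.re := hq
  have h2 := Complex.re_le_norm q
  nlinarith [norm_nonneg q]

lemma normSq_one_sub (q : ℂ) : ‖1 - q‖ ^ 2 = 1 - 2 * q.re + ‖q‖ ^ 2 := by
  rw [Complex.sq_norm, Complex.sq_norm, Complex.normSq_apply, Complex.normSq_apply]
  simp
  ring

lemma one_sub_mem_disc {q : ℂ} (hq : q ∈ disc) : 1 - q ∈ disc := by
  have h1 : ‖q‖ ^ 2 ≤ q.re := hq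
  change ‖1 - q‖ ^ 2 ≤ (1 - q).re
  rw [normSq_one_sub, Complex.sub_re, Complex.one_re]
  linarith

/-- Away from `0` the disc is `Re (1 / r) ≥ 1`, and `r / (1 + β r)` is the inverse of `1 / r + β`,
so adding `β` with `Re β ≥ 0` preserves it. This inequality is the form free of division, valid at
`r = 0` too. -/
lemma norm_sq_le_re_mul_conj {β r : ℂ} (hβ : 0 ≤ β.re) (hr : r ∈ disc) :
    ‖r‖ ^ 2 ≤ (r * (starRingEnd ℂ) (1 + β * r)).re := by
  have h1 : ‖r‖ ^ 2 ≤ r.re := hr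
  have h2 : (r * (starRingEnd ℂ) (1 + β * r)).re = r.re + β.re * ‖r‖ ^ 2 := by
    rw [Complex.sq_norm, Complex.normSq_apply]
    simp
    ring
  rw [h2]
  have : 0 ≤ β.re * ‖r‖ ^ 2 := by positivity
  linarith

lemma one_add_mul_mem_slitPlane {β r : ℂ} (hβ : 0 ≤ β.re) (hr : r ∈ disc) :
    1 + β * r ∈ Complex.slitPlane := by
  by_contra h
  rw [Complex.mem_slitPlane_iff] at h
  push Not at h
  obtain ⟨h1, h2⟩ := h
  have h3 := norm_sq_le_re_mul_conj hβ hr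
  have h4 : ‖r‖ ^ 2 ≤ r.re := hr
  rw [Complex.mul_re, Complex.conj_re, Complex.conj_im, h2] at h3
  have h5 : ‖r‖ ^ 2 = 0 := by nlinarith [sq_nonneg ‖r‖]
  have h6 : r = 0 := by simpa using h5
  rw [h6] at h1
  simp at h1
  linarith

/-- Add `1 - ‖β‖ * ‖r‖ ≤ ‖1 + β * r‖` to `‖β‖` times `‖r‖ ≤ ‖1 + β * r‖`; the latter follows from
`norm_sq_le_re_mul_conj`. -/
lemma one_le_mul_norm_one_add_mul {β r : ℂ} (hβ : 0 ≤ β.re) (hr : r ∈ disc) :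
    1 ≤ (1 + ‖β‖) * ‖1 + β * r‖ := by
  have h3 := norm_sq_le_re_mul_conj hβ hr
  have h4 := Complex.re_le_norm (r * (starRingEnd ℂ) (1 + β * r))
  rw [norm_mul, Complex.norm_conj] at h4
  have h5 : ‖r‖ ≤ ‖1 + β * r‖ := by
    rcases (norm_nonneg r).eq_or_lt with h | h
    · rw [← h]; exact norm_nonneg _
    · nlinarith
  have h6 : 1 - ‖β‖ * ‖r‖ ≤ ‖1 + β * r‖ := by
    have := norm_sub_norm_le (1 : ℂ) (-(β * r))
    simpa using this
  nlinarith [norm_nonneg β, mul_le_mul_of_nonneg_left h5 (norm_nonneg β)]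

lemma norm_one_add_mul_le {β r : ℂ} (hr : r ∈ disc) : ‖1 + β * r‖ ≤ 1 + ‖β‖ := by
  refine (norm_add_le _ _).trans ?_
  rw [norm_one, norm_mul]
  have := norm_le_one_of_mem_disc hr
  have := mul_le_mul_of_nonneg_left this (norm_nonneg β)
  linarith

lemma one_add_mul_ne_zero {β r : ℂ} (hβ : 0 ≤ β.re) (hr : r ∈ disc) : 1 + β * r ≠ 0 :=
  Complex.slitPlane_ne_zero (one_add_mul_mem_slitPlane hβ hr)

lemma abs_log_norm_one_add_mul_le {β r : ℂ} (hβ : 0 ≤ β.re) (hr : r ∈ disc) :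
    |Real.log ‖1 + β * r‖| ≤ ‖β‖ := by
  have hpos : 0 < ‖1 + β * r‖ := norm_pos_iff.2 (one_add_mul_ne_zero hβ hr)
  have h1 := one_le_mul_norm_one_add_mul hβ hr
  have h0 : (0 : ℝ) < 1 + ‖β‖ := by positivity
  have h2 := Real.log_nonneg h1
  rw [Real.log_mul h0.ne' hpos.ne'] at h2
  have h3 := Real.log_le_log hpos (norm_one_add_mul_le hr)
  have h4 := Real.log_le_sub_one_of_pos h0
  rw [abs_le]
  constructor <;> linarith

lemma div_one_add_mul_mem_disc {β r : ℂ} (hβ : 0 ≤ β.re) (hr : r ∈ disc) :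
    r / (1 + β * r) ∈ disc := by
  have h3 := norm_sq_le_re_mul_conj hβ hr
  have hne := one_add_mul_ne_zero hβ hr
  have hpos : 0 < ‖1 + β * r‖ ^ 2 := by positivity
  change ‖r / (1 + β * r)‖ ^ 2 ≤ (r / (1 + β * r)).re
  have h5 : r / (1 + β * r)
      = r * (starRingEnd ℂ) (1 + β * r) * ((‖1 + β * r‖ ^ 2)⁻¹ : ℝ) := by
    rw [div_eq_mul_inv, Complex.inv_def, Complex.normSq_eq_norm_sq, mul_assoc]
  rw [norm_div, div_pow, h5, Complex.re_mul_ofReal, ← div_eq_mul_inv]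
  gcongr

/-- The pairs `(x, y)` with nonzero sum for which `x / (x + y)` lies in `disc`. -/
def InCone (x y : ℂ) : Prop := ∃ q ∈ disc, ∃ u : ℂ, u ≠ 0 ∧ x = q * u ∧ y = (1 - q) * u

/-- As `mat` is a symmetric matrix, this one map is both its row and its column action. -/
lemma InCone.step {x y β : ℂ} (hβ : 0 ≤ β.re) (h : InCone x y) : InCone y (x + β * y) := by
  obtain ⟨q, hq, u, hu, rfl, rfl⟩ := h
  have hr := one_sub_mem_disc hq
  have hne := one_add_mul_ne_zero hβ hr
  refine ⟨(1 - q) / (1 + β * (1 - q)), div_one_add_mul_mem_disc hβ hr,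
    (1 + β * (1 - q)) * u, mul_ne_zero hne hu, ?_, ?_⟩
  · rw [← mul_assoc, div_mul_cancel₀ _ hne]
  · field_simp
    ring

lemma InCone.sq_add_sq_le {x y : ℂ} (h : InCone x y) : ‖x‖ ^ 2 + ‖y‖ ^ 2 ≤ ‖x + y‖ ^ 2 := by
  obtain ⟨q, hq, u, hu, rfl, rfl⟩ := h
  have e : q * u + (1 - q) * u = u := by ring
  have h1 : ‖q‖ ^ 2 ≤ q.re := hq
  rw [e, norm_mul, norm_mul, mul_pow, mul_pow, normSq_one_sub]
  nlinarith [sq_nonneg ‖u‖]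

variable {α : ℝ} {a : ℕ → ℝ}

lemma re_mul_phase_nonneg (hα : 0 ≤ (phase α).re) {x : ℝ} (hx : 0 ≤ x) :
    0 ≤ ((x : ℂ) * phase α).re := by
  rw [Complex.re_ofReal_mul]
  positivity

lemma inCone_vecMul (hα : 0 ≤ (phase α).re) (ha : ∀ k, 0 ≤ a k) {x y : ℂ} (h : InCone x y)
    (n : ℕ) : InCone (x * prodMat α a n 0 0 + y * prodMat α a n 1 0)
      (x * prodMat α a n 0 1 + y * prodMat α a n 1 1) := by
  induction n with
  | zero => simpa [prodMat] using h
  | succ n ih =>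
    convert ih.step (re_mul_phase_nonneg hα (ha n)) using 1
    · simp [prodMat, mat_eq, Matrix.mul_apply, Fin.sum_univ_two]
    · simp [prodMat, mat_eq, Matrix.mul_apply, Fin.sum_univ_two]
      ring

lemma inCone_mulVec (hα : 0 ≤ (phase α).re) (ha : ∀ k, 0 ≤ a k) (n : ℕ) : ∀ {x y : ℂ},
    InCone x y → InCone (prodMat α a n 0 0 * x + prodMat α a n 0 1 * y)
      (prodMat α a n 1 0 * x + prodMat α a n 1 1 * y) := by
  induction n with
  | zero => intro x y h; simpa [prodMat] using h
  | succ n ih =>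
    intro x y h
    convert ih (h.step (re_mul_phase_nonneg hα (ha n))) using 1 <;>
    · simp [prodMat, mat_eq, Matrix.mul_apply, Fin.sum_univ_two]
      ring

/-- The sum of the entries of the product. -/
def entrySum (α : ℝ) (a : ℕ → ℝ) (n : ℕ) : ℂ :=
  prodMat α a n 0 0 + prodMat α a n 0 1 + (prodMat α a n 1 0 + prodMat α a n 1 1)

/-- `InCone.sq_add_sq_le` is used three times: on each row of the product, then on the pair of row
sums. The Frobenius norm is thus at most the modulus of the entry sum. -/
lemma opNorm_prodMat_le (hα : 0 ≤ (phase α).re) (ha : ∀ k, 0 ≤ a k) (n : ℕ) :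
    opNorm (prodMat α a n) ≤ ‖entrySum α a n‖ := by
  refine le_of_sq_le_sq ((opNorm_sq_le _).trans ?_) (norm_nonneg _)
  have h1 := (inCone_vecMul hα ha (x := 1) (y := 0)
    ⟨1, by simp [disc], 1, one_ne_zero, by simp, by simp⟩ n).sq_add_sq_le
  have h2 := (inCone_vecMul hα ha (x := 0) (y := 1)
    ⟨0, by simp [disc], 1, one_ne_zero, by simp, by simp⟩ n).sq_add_sq_le
  have h3 := (inCone_mulVec hα ha n (x := 1) (y := 1)
    ⟨1 / 2, by simp [disc]; norm_num, 2, two_ne_zero, by simp, by norm_num⟩).sq_add_sq_le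
  simp only [one_mul, zero_mul, add_zero, zero_add, mul_one] at h1 h2 h3
  rw [entrySum]
  linarith

lemma norm_entrySum_le (n : ℕ) : ‖entrySum α a n‖ ≤ 2 * opNorm (prodMat α a n) := by
  have h := sq_add_sq_le_opNorm (prodMat α a n) 1 1
  simp only [mul_one, norm_one] at h
  have h2 := norm_add_le (prodMat α a n 0 0 + prodMat α a n 0 1)
    (prodMat α a n 1 0 + prodMat α a n 1 1)
  refine le_of_sq_le_sq ?_ (by linarith [opNorm_nonneg (prodMat α a n)])
  have h3 := pow_le_pow_left₀ (norm_nonneg _) h2 2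
  rw [entrySum]
  nlinarith [sq_nonneg (‖prodMat α a n 0 0 + prodMat α a n 0 1‖
    - ‖prodMat α a n 1 0 + prodMat α a n 1 1‖)]

lemma entrySum_ne_zero (hα : 0 ≤ (phase α).re) (ha : ∀ k, 0 ≤ a k) (n : ℕ) :
    entrySum α a n ≠ 0 := by
  have := opNorm_prodMat_le hα ha n
  have := one_le_opNorm_prodMat α a n
  rw [← norm_pos_iff]
  linarith

lemma abs_log_opNorm_sub_le (hα : 0 ≤ (phase α).re) (ha : ∀ k, 0 ≤ a k) (n : ℕ) :
    |Real.log (opNorm (prodMat α a n)) - Real.log ‖entrySum α a n‖| ≤ Real.log 2 := by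
  have h1 := opNorm_prodMat_le hα ha n
  have h2 := norm_entrySum_le (α := α) (a := a) n
  have h3 := one_le_opNorm_prodMat α a n
  have h4 := Real.log_le_log (by linarith) h1
  have h5 := Real.log_le_log (by linarith) h2
  rw [Real.log_mul two_ne_zero (by linarith)] at h5
  rw [abs_le]
  have := Real.log_nonneg one_le_two
  constructor <;> linarith

/-- One step of the projective action in the coordinate `x / (x + y)`. -/
def ratioStep (α x : ℝ) (q : ℂ) : ℂ := (1 - q) / (1 + x * phase α * (1 - q))

/-- The orbit of `1 / 2` under the projective action. -/
def ratio (α : ℝ) (a : ℕ → ℝ) : ℕ → ℂ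
  | 0 => 1 / 2
  | n + 1 => ratioStep α (a n) (ratio α a n)

lemma ratioStep_mem_disc (hα : 0 ≤ (phase α).re) {x : ℝ} (hx : 0 ≤ x) {q : ℂ} (hq : q ∈ disc) :
    ratioStep α x q ∈ disc :=
  div_one_add_mul_mem_disc (re_mul_phase_nonneg hα hx) (one_sub_mem_disc hq)

lemma ratio_mem_disc (hα : 0 ≤ (phase α).re) (ha : ∀ k, 0 ≤ a k) (n : ℕ) :
    ratio α a n ∈ disc := by
  induction n with
  | zero => simp [ratio, disc]; norm_num
  | succ n ih => exact ratioStep_mem_disc hα (ha n) ih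

/-- `ratio` is the normalised first entry of the row vector `(1, 1) * prodMat`, whose entries add up
to `entrySum`. The second identity makes `log ‖entrySum‖` an additive functional of the chain. -/
lemma ratio_mul_entrySum (hα : 0 ≤ (phase α).re) (ha : ∀ k, 0 ≤ a k) (n : ℕ) :
    ratio α a n * entrySum α a n = prodMat α a n 0 0 + prodMat α a n 1 0 ∧
      entrySum α a (n + 1) = (1 + a n * phase α * (1 - ratio α a n)) * entrySum α a n := by
  have key : ∀ n, ratio α a n * entrySum α a n = prodMat α a n 0 0 + prodMat α a n 1 0 →
      entrySum α a (n + 1) = (1 + a n * phase α * (1 - ratio α a n)) * entrySum α a n := by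
    intro n h
    have e : (1 - ratio α a n) * entrySum α a n = prodMat α a n 0 1 + prodMat α a n 1 1 := by
      rw [sub_mul, h, entrySum]
      ring
    rw [add_mul, mul_assoc, e]
    simp [entrySum, prodMat, mat_eq, Matrix.mul_apply, Fin.sum_univ_two]
    ring
  have h0 : ratio α a n * entrySum α a n = prodMat α a n 0 0 + prodMat α a n 1 0 := by
    induction n with
    | zero => simp [ratio, entrySum, prodMat]; norm_num
    | succ n ih =>
      have hne := one_add_mul_ne_zero (re_mul_phase_nonneg hα (ha n))
        (one_sub_mem_disc (ratio_mem_disc hα ha n))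
      rw [key n ih, ratio, ratioStep, ← mul_assoc, div_mul_cancel₀ _ hne, sub_mul, ih]
      simp [entrySum, prodMat, mat_eq, Matrix.mul_apply, Fin.sum_univ_two]
      ring
  exact ⟨h0, key n h0⟩

lemma log_norm_entrySum_succ (hα : 0 ≤ (phase α).re) (ha : ∀ k, 0 ≤ a k) (n : ℕ) :
    Real.log ‖entrySum α a (n + 1)‖
      = Real.log ‖entrySum α a n‖ + Real.log ‖1 + a n * phase α * (1 - ratio α a n)‖ := by
  have hne := one_add_mul_ne_zero (re_mul_phase_nonneg hα (ha n))
    (one_sub_mem_disc (ratio_mem_disc hα ha n))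
  rw [(ratio_mul_entrySum hα ha n).2, norm_mul, Real.log_mul (norm_ne_zero_iff.2 hne)
    (norm_ne_zero_iff.2 (entrySum_ne_zero hα ha n)), add_comm]

lemma measurable_ratioStep (α : ℝ) : Measurable fun z : ℂ × ℝ => ratioStep α z.2 z.1 := by
  unfold ratioStep
  fun_prop

lemma measurable_ratio (α : ℝ) (n : ℕ) : Measurable fun a => ratio α a n := by
  induction n with
  | zero => exact measurable_const
  | succ n ih => exact (measurable_ratioStep α).comp (ih.prodMk (measurable_pi_apply n))

lemma dependsOn_ratio (α : ℝ) (n : ℕ) : DependsOn (fun a => ratio α a n) (Finset.range n) := by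
  intro a b h
  induction n with
  | zero => rfl
  | succ n ih =>
    simp only [ratio]
    have h1 := ih fun i hi => h i (by simp at hi ⊢; omega)
    simp only at h1
    rw [h1, h n (by simp)]

end

/-! ### Approximate correctors and the Lyapunov exponent. -/

section

lemma map_pair_eq_prod {ν : Measure ℝ} [IsProbabilityMeasure ν] (α : ℝ) (n : ℕ) :
    (iidLaw ν).map (fun a => (ratio α a n, a n))
      = ((iidLaw ν).map fun a => ratio α a n).prod ν := by
  have h := indepFun_of_dependsOn ν (measurable_ratio α n) (measurable_pi_apply (X := fun _ => ℝ) n)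
    (S := Finset.range n) (T := {n}) (by simp) (dependsOn_ratio α n)
    (fun a b hab => hab n (by simp))
  rw [(indepFun_iff_map_prod_eq_prod_map_map (measurable_ratio α n).aemeasurable
    (measurable_pi_apply n).aemeasurable).1 h]
  congr 1
  exact (measurePreserving_eval_infinitePi (fun _ : ℕ => ν) n).map_eq

lemma ae_forall_nonneg {ν : Measure ℝ} [IsProbabilityMeasure ν] (hν : ∀ᵐ x ∂ν, 0 ≤ x) :
    ∀ᵐ a ∂iidLaw ν, ∀ k, 0 ≤ a k :=
  ae_all_iff.2 fun k =>
    (measurePreserving_eval_infinitePi (fun _ : ℕ => ν) k).quasiMeasurePreserving.ae hν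

/-- The increment of `log ‖entrySum‖ + Φ ∘ ratio`. -/
def increment (α : ℝ) (Φ : ℂ → ℝ) (z : ℂ × ℝ) : ℝ :=
  Real.log ‖1 + z.2 * phase α * (1 - z.1)‖ + Φ (ratioStep α z.2 z.1) - Φ z.1

variable {α : ℝ} {Φ : ℂ → ℝ} {B : ℝ}

lemma measurable_increment (α : ℝ) (hΦ : Measurable Φ) : Measurable (increment α Φ) := by
  have h1 : Measurable fun z : ℂ × ℝ => Real.log ‖1 + z.2 * phase α * (1 - z.1)‖ := by fun_prop
  exact (h1.add (hΦ.comp (measurable_ratioStep α))).sub (hΦ.comp measurable_fst)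

lemma abs_increment_le (hα : 0 ≤ (phase α).re) (hB : ∀ q ∈ disc, |Φ q| ≤ B) {q : ℂ}
    (hq : q ∈ disc) {x : ℝ} (hx : 0 ≤ x) : |increment α Φ (q, x)| ≤ x + 2 * B := by
  have h1 := abs_log_norm_one_add_mul_le (re_mul_phase_nonneg hα hx) (one_sub_mem_disc hq)
  rw [norm_mul, norm_phase, Complex.norm_real, Real.norm_of_nonneg hx, mul_one] at h1
  have h2 := hB _ (ratioStep_mem_disc hα hx hq)
  have h3 := hB _ hq
  simp only [increment]
  rw [abs_le] at *
  constructor <;> linarith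

/-- A bounded approximate corrector determines the Lyapunov exponent approximately. -/
theorem abs_lyapunovExponent_sub_le {p s ε Λ : ℝ} (hp : 0 < p) (hs : 0 < s)
    (hα : 0 ≤ (phase α).re) (hΦ : Measurable Φ) (hB : ∀ q ∈ disc, |Φ q| ≤ B)
    (hε : ∀ q ∈ disc, |∫ x, increment α Φ (q, x) ∂gammaMeasure p s⁻¹ - Λ| ≤ ε) :
    |lyapunovExponent p s α - Λ| ≤ ε := by
  have hprob := isProbabilityMeasure_gammaMeasure hp (inv_pos.2 hs)
  set ν := gammaMeasure p s⁻¹ with hν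
  have hnn : ∀ᵐ a ∂iidLaw ν, ∀ k, 0 ≤ a k := ae_forall_nonneg (ae_nonneg_gammaMeasure p _)
  have hx : Integrable (fun x : ℝ => x) ν := by simpa using integrable_pow_gammaMeasure hp hs 1
  have hcoord : ∀ k, Integrable (fun a : ℕ → ℝ => a k) (iidLaw ν) := fun k =>
    (measurePreserving_eval_infinitePi (fun _ : ℕ => ν) k).integrable_comp_of_integrable hx
  obtain ⟨hint, hmean, -⟩ := lyapunovExponent_spec α hp hs
  change ∀ n, Integrable _ (iidLaw ν) at hint
  set inc : ℕ → (ℕ → ℝ) → ℝ := fun n a => increment α Φ (ratio α a n, a n) with hinc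
  have hincm : ∀ n, Measurable (inc n) := fun n =>
    (measurable_increment α hΦ).comp ((measurable_ratio α n).prodMk (measurable_pi_apply n))
  have hinci : ∀ n, Integrable (inc n) (iidLaw ν) := by
    intro n
    refine ((hcoord n).add (integrable_const (2 * B))).mono' (hincm n).aestronglyMeasurable ?_
    filter_upwards [hnn] with a ha
    exact abs_increment_le hα hB (ratio_mem_disc hα ha n) (ha n)
  have hincε : ∀ n, |∫ a, inc n a ∂iidLaw ν - Λ| ≤ ε := by
    intro n
    have hmap := map_pair_eq_prod (ν := ν) α n
    have hpair : Measurable fun a : ℕ → ℝ => (ratio α a n, a n) :=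
      (measurable_ratio α n).prodMk (measurable_pi_apply n)
    have := Measure.isProbabilityMeasure_map (μ := iidLaw ν) (measurable_ratio α n).aemeasurable
    have hprodi : Integrable (increment α Φ) (((iidLaw ν).map fun a => ratio α a n).prod ν) := by
      rw [← hmap]
      exact (integrable_map_measure (measurable_increment α hΦ).aestronglyMeasurable
        hpair.aemeasurable).2 (hinci n)
    have e1 : ∫ a, inc n a ∂iidLaw ν
        = ∫ q, ∫ x, increment α Φ (q, x) ∂ν ∂((iidLaw ν).map fun a => ratio α a n) := by
      rw [← integral_prod _ hprodi, ← hmap, integral_map hpair.aemeasurable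
        (measurable_increment α hΦ).aestronglyMeasurable]
    -- By independence, first integrate over the new variable with `q` fixed. The resulting bound
    -- holds at every point of the disc, so the law of `ratio α a n` is irrelevant.
    have e2 : ∫ a, inc n a ∂iidLaw ν - Λ = ∫ q, (∫ x, increment α Φ (q, x) ∂ν - Λ)
        ∂((iidLaw ν).map fun a => ratio α a n) := by
      rw [integral_sub hprodi.integral_prod_left (integrable_const _), e1]
      simp
    rw [e2, ← Real.norm_eq_abs]
    refine (norm_integral_le_of_norm_le_const (C := ε) ?_).trans (by simp)
    refine (ae_map_iff (measurable_ratio α n).aemeasurable ?_).2 ?_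
    · refine measurableSet_le ?_ measurable_const
      have hs : StronglyMeasurable fun q : ℂ => ∫ x, increment α Φ (q, x) ∂ν :=
        (measurable_increment α hΦ).stronglyMeasurable.integral_prod_right'
      exact (hs.measurable.sub_const Λ).norm
    · filter_upwards [hnn] with a ha
      exact hε _ (ratio_mem_disc hα ha n)
  have hΦi : ∀ n, Integrable (fun a => Φ (ratio α a n)) (iidLaw ν) := by
    intro n
    refine (integrable_const B).mono' (hΦ.comp (measurable_ratio α n)).aestronglyMeasurable ?_
    filter_upwards [hnn] with a ha
    exact hB _ (ratio_mem_disc hα ha n)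
  -- One `log 2` compares the norm with the entry sum, the other is the initial entry sum of the
  -- identity; `2 * B` bounds the two end values of `Φ`.
  have htel : ∀ n, ∀ᵐ a ∂iidLaw ν,
      |Real.log (opNorm (prodMat α a n)) - ∑ k ∈ Finset.range n, inc k a|
        ≤ 2 * Real.log 2 + 2 * B := by
    intro n
    filter_upwards [hnn] with a ha
    have hsum : ∑ k ∈ Finset.range n, inc k a
        = (Real.log ‖entrySum α a n‖ + Φ (ratio α a n)) - (Real.log 2 + Φ (ratio α a 0)) := by
      have e0 : Real.log 2 = Real.log ‖entrySum α a 0‖ := by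
        congr 1
        simp [entrySum, prodMat]
        norm_num
      rw [e0, ← Finset.sum_range_sub (fun n => Real.log ‖entrySum α a n‖ + Φ (ratio α a n))]
      refine Finset.sum_congr rfl fun k _ => ?_
      rw [log_norm_entrySum_succ hα ha]
      simp only [hinc, increment, ratio]
      ring
    have h1 := abs_log_opNorm_sub_le hα ha n
    have h2 := hB _ (ratio_mem_disc hα ha n)
    have h3 := hB _ (ratio_mem_disc hα ha 0)
    rw [hsum]
    have := Real.log_nonneg one_le_two
    rw [abs_le] at *
    constructor <;> linarith
  have hbound : ∀ n : ℕ, |meanLogNorm p s α n - n * Λ|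
      ≤ (2 * Real.log 2 + 2 * B) + n * ε := by
    intro n
    have hsumi := integrable_finsetSum (Finset.range n) fun k _ => hinci k
    have h1 : |meanLogNorm p s α n - ∫ a, ∑ k ∈ Finset.range n, inc k a ∂iidLaw ν|
        ≤ 2 * Real.log 2 + 2 * B := by
      change |∫ a, Real.log (opNorm (prodMat α a n)) ∂iidLaw ν - _| ≤ _
      rw [← integral_sub (hint n) hsumi, ← Real.norm_eq_abs]
      exact (norm_integral_le_of_norm_le_const (htel n)).trans (by simp)
    have h2 : |∫ a, ∑ k ∈ Finset.range n, inc k a ∂iidLaw ν - n * Λ| ≤ n * ε := by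
      rw [integral_finsetSum _ fun k _ => hinci k]
      have e : (n : ℝ) * Λ = ∑ k ∈ Finset.range n, Λ := by simp
      rw [e, ← Finset.sum_sub_distrib]
      refine (Finset.abs_sum_le_sum_abs _ _).trans ?_
      refine (Finset.sum_le_sum fun k _ => hincε k).trans (by simp)
    rw [abs_le] at *
    constructor <;> linarith
  have hlim : Tendsto (fun n : ℕ => |meanLogNorm p s α n / n - Λ|) atTop
      (𝓝 |lyapunovExponent p s α - Λ|) := (hmean.sub_const Λ).abs
  have hlim2 : Tendsto (fun n : ℕ => (2 * Real.log 2 + 2 * B) / n + ε) atTop (𝓝 (0 + ε)) :=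
    (tendsto_const_nhds.div_atTop tendsto_natCast_atTop_atTop).add_const ε
  rw [zero_add] at hlim2
  refine le_of_tendsto_of_tendsto hlim hlim2 ?_
  filter_upwards [eventually_gt_atTop 0] with n hn
  have hn' : (0 : ℝ) < n := by exact_mod_cast hn
  have e : meanLogNorm p s α n / n - Λ = (meanLogNorm p s α n - n * Λ) / n := by
    field_simp
  rw [e, abs_div, abs_of_pos hn', div_add' _ _ _ hn'.ne']
  gcongr
  have := hbound n
  linarith

end

/-! ### Taylor expansions with remainders uniform on the disc. -/

section

/-- The Taylor coefficients of `(1 + x)⁻¹ ^ m`. -/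
def invPowCoeff (m k : ℕ) : ℂ := (-1) ^ k * (m + k - 1).choose k

lemma invPowCoeff_zero_right (m : ℕ) : invPowCoeff m 0 = 1 := by simp [invPowCoeff]

lemma invPowCoeff_zero_left (k : ℕ) : invPowCoeff 0 (k + 1) = 0 := by
  simp [invPowCoeff]

lemma invPowCoeff_succ (m k : ℕ) :
    invPowCoeff (m + 1) (k + 1) + invPowCoeff (m + 1) k = invPowCoeff m (k + 1) := by
  have h := Nat.choose_succ_succ (m + k) k
  have e1 : m + 1 + (k + 1) - 1 = m + k + 1 := by omega
  have e2 : m + 1 + k - 1 = m + k := by omega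
  have e3 : m + (k + 1) - 1 = m + k := by omega
  simp only [invPowCoeff, e1, e2, e3, h, Nat.succ_eq_add_one]
  push_cast
  ring

lemma one_add_mul_sum_invPowCoeff (m N : ℕ) (x : ℂ) :
    (1 + x) * ∑ k ∈ Finset.range (N + 1), invPowCoeff (m + 1) k * x ^ k
      = ∑ k ∈ Finset.range (N + 1), invPowCoeff m k * x ^ k
        + invPowCoeff (m + 1) N * x ^ (N + 1) := by
  induction N with
  | zero => simp [invPowCoeff_zero_right]
  | succ N ih =>
    rw [Finset.sum_range_succ, mul_add, ih, Finset.sum_range_succ _ (N + 1), ← invPowCoeff_succ m N]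
    ring

/-- No smallness of `x` is assumed, since the gamma variable is unbounded; a bound on `(1 + x)⁻¹`
replaces it. In the induction, `1 + x` times the truncation for `m + 1` is the truncation for `m`
plus one boundary term. -/
lemma exists_norm_inv_pow_sub_le (m N : ℕ) : ∃ C : ℝ, 0 ≤ C ∧ ∀ (x : ℂ) (M : ℝ), 1 ≤ M →
    1 + x ≠ 0 → ‖(1 + x)⁻¹‖ ≤ M →
    ‖(1 + x)⁻¹ ^ m - ∑ k ∈ Finset.range (N + 1), invPowCoeff m k * x ^ k‖
      ≤ C * ‖x‖ ^ (N + 1) * M ^ m := by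
  induction m with
  | zero =>
    refine ⟨0, le_rfl, fun x M _ _ _ => ?_⟩
    rw [Finset.sum_range_succ']
    simp [invPowCoeff_zero_left, invPowCoeff_zero_right]
  | succ m ih =>
    obtain ⟨C, hC, h⟩ := ih
    refine ⟨C + ‖invPowCoeff (m + 1) N‖, by positivity, fun x M hM hx hxM => ?_⟩
    have e : (1 + x)⁻¹ ^ (m + 1) - ∑ k ∈ Finset.range (N + 1), invPowCoeff (m + 1) k * x ^ k
        = (1 + x)⁻¹ * (((1 + x)⁻¹ ^ m - ∑ k ∈ Finset.range (N + 1), invPowCoeff m k * x ^ k)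
          - invPowCoeff (m + 1) N * x ^ (N + 1)) := by
      rw [sub_sub, ← one_add_mul_sum_invPowCoeff, mul_sub, ← mul_assoc, inv_mul_cancel₀ hx,
        one_mul, pow_succ, mul_comm]
    rw [e, norm_mul]
    have h1 : ‖((1 + x)⁻¹ ^ m - ∑ k ∈ Finset.range (N + 1), invPowCoeff m k * x ^ k)
        - invPowCoeff (m + 1) N * x ^ (N + 1)‖
        ≤ (C + ‖invPowCoeff (m + 1) N‖) * ‖x‖ ^ (N + 1) * M ^ m := by
      refine (norm_sub_le _ _).trans ?_
      rw [norm_mul, norm_pow]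
      have h2 := h x M hM hx hxM
      have h3 : ‖invPowCoeff (m + 1) N‖ * ‖x‖ ^ (N + 1)
          ≤ ‖invPowCoeff (m + 1) N‖ * ‖x‖ ^ (N + 1) * M ^ m :=
        le_mul_of_one_le_right (by positivity) (one_le_pow₀ hM)
      linarith
    calc ‖(1 + x)⁻¹‖ * _ ≤ M * ((C + ‖invPowCoeff (m + 1) N‖) * ‖x‖ ^ (N + 1) * M ^ m) := by
          gcongr
      _ = _ := by ring

/-- The remainder has derivative `(-z) ^ N * (1 + z)⁻¹`, which is bounded along the segment from `0`
to `x`. In the application, the factor `τ` only rescales the gamma variable, so the disc estimates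
hold on the whole segment. -/
lemma norm_log_one_add_sub_logTaylor_le {x : ℂ} {M : ℝ} (N : ℕ)
    (hx : ∀ τ ∈ Set.Icc (0 : ℝ) 1, 1 + τ * x ∈ Complex.slitPlane ∧ ‖(1 + τ * x)⁻¹‖ ≤ M) :
    ‖Complex.log (1 + x) - Complex.logTaylor (N + 1) x‖ ≤ ‖x‖ ^ (N + 1) * M := by
  set F : ℂ → ℂ := fun z => Complex.log (1 + z) - Complex.logTaylor (N + 1) z with hF
  have hder : ∀ τ ∈ Set.Icc (0 : ℝ) 1, HasDerivWithinAt (fun τ : ℝ => F (τ * x))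
      ((-(τ * x)) ^ N * (1 + τ * x)⁻¹ * x) (Set.Icc 0 1) τ := by
    intro τ hτ
    have h1 := Complex.hasDerivAt_log_sub_logTaylor N (hx τ hτ).1
    have h2 : HasDerivAt (fun τ : ℝ => (τ : ℂ) * x) x τ := by
      simpa using (Complex.ofRealCLM.hasDerivAt (x := τ)).mul_const x
    exact (h1.comp τ h2).hasDerivWithinAt
  have h := norm_image_sub_le_of_norm_deriv_le_segment_01' (C := ‖x‖ ^ (N + 1) * M) hder
    (fun τ hτ => by
      have h1 := (hx τ ⟨hτ.1, hτ.2.le⟩).2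
      rw [norm_mul, norm_mul, norm_pow, norm_neg, norm_mul, Complex.norm_real,
        Real.norm_of_nonneg hτ.1]
      have h2 : τ * ‖x‖ ≤ ‖x‖ := mul_le_of_le_one_left (norm_nonneg _) hτ.2.le
      have h3 : 0 ≤ τ * ‖x‖ := mul_nonneg hτ.1 (norm_nonneg _)
      calc (τ * ‖x‖) ^ N * ‖(1 + τ * x)⁻¹‖ * ‖x‖ ≤ ‖x‖ ^ N * M * ‖x‖ := by gcongr
        _ = _ := by ring)
  simpa [hF, Complex.logTaylor_at_zero] using h

lemma norm_inv_one_add_mul_le {β r : ℂ} (hβ : 0 ≤ β.re) (hr : r ∈ disc) :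
    ‖(1 + β * r)⁻¹‖ ≤ 1 + ‖β‖ := by
  rw [norm_inv]
  exact inv_le_of_inv_le₀ (by positivity) (by
    rw [inv_le_iff_one_le_mul₀ (by positivity), mul_comm]
    exact one_le_mul_norm_one_add_mul hβ hr)

variable {α : ℝ}

lemma norm_mul_phase {x : ℝ} (hx : 0 ≤ x) : ‖(x : ℂ) * phase α‖ = x := by
  rw [norm_mul, norm_phase, mul_one, Complex.norm_real, Real.norm_of_nonneg hx]

lemma norm_log_ratio_sub_le (hα : 0 ≤ (phase α).re) (N : ℕ) {x : ℝ} (hx : 0 ≤ x) {q : ℂ}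
    (hq : q ∈ disc) :
    ‖Complex.log (1 + x * phase α * (1 - q))
      - Complex.logTaylor (N + 1) (x * phase α * (1 - q))‖ ≤ x ^ (N + 1) * (1 + x) := by
  have hr := one_sub_mem_disc hq
  refine (norm_log_one_add_sub_logTaylor_le (M := 1 + x) N fun τ hτ => ?_).trans ?_
  · have e : (1 : ℂ) + τ * (x * phase α * (1 - q)) = 1 + ((τ * x : ℝ) * phase α) * (1 - q) := by
      push_cast; ring
    have hτx : 0 ≤ τ * x := mul_nonneg hτ.1 hx
    rw [e]
    refine ⟨one_add_mul_mem_slitPlane (re_mul_phase_nonneg hα hτx) hr,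
      (norm_inv_one_add_mul_le (re_mul_phase_nonneg hα hτx) hr).trans ?_⟩
    rw [norm_mul_phase hτx]
    have := mul_le_of_le_one_left hx hτ.2
    linarith
  · rw [norm_mul, norm_mul_phase hx]
    gcongr
    exact mul_le_of_le_one_right hx (norm_le_one_of_mem_disc hr)

open Polynomial

/-- The coefficient of `β ^ k` in `f ((1 - X) / (1 + β (1 - X)))`. -/
def taylorOp (k : ℕ) : ℂ[X] →ₗ[ℂ] ℂ[X] :=
  Polynomial.lsum fun m => LinearMap.toSpanSingleton ℂ ℂ[X]
    (C (invPowCoeff m k) * (1 - X) ^ (m + k))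

lemma taylorOp_monomial (k m : ℕ) (c : ℂ) :
    taylorOp k (monomial m c) = c • (C (invPowCoeff m k) * (1 - X) ^ (m + k)) := by
  simp [taylorOp, Polynomial.lsum_apply, Polynomial.sum_monomial_index]

lemma exists_norm_eval_ratioStep_sub_le (hα : 0 ≤ (phase α).re) (N : ℕ) (f : ℂ[X]) :
    ∃ (C : ℝ) (d : ℕ), 0 ≤ C ∧ ∀ (x : ℝ), 0 ≤ x → ∀ q ∈ disc,
      ‖f.eval (ratioStep α x q)
        - ∑ k ∈ Finset.range (N + 1), (x : ℂ) ^ k * (phase α ^ k * (taylorOp k f).eval q)‖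
        ≤ C * (x ^ (N + 1) * (1 + x) ^ d) := by
  induction f using Polynomial.induction_on' with
  | add f g hf hg =>
    obtain ⟨C₁, d₁, hC₁, h₁⟩ := hf
    obtain ⟨C₂, d₂, hC₂, h₂⟩ := hg
    refine ⟨C₁ + C₂, d₁ + d₂, by positivity, fun x hx q hq => ?_⟩
    have e : (f + g).eval (ratioStep α x q) - ∑ k ∈ Finset.range (N + 1),
          (x : ℂ) ^ k * (phase α ^ k * (taylorOp k (f + g)).eval q)
        = (f.eval (ratioStep α x q) - ∑ k ∈ Finset.range (N + 1),
          (x : ℂ) ^ k * (phase α ^ k * (taylorOp k f).eval q))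
        + (g.eval (ratioStep α x q) - ∑ k ∈ Finset.range (N + 1),
          (x : ℂ) ^ k * (phase α ^ k * (taylorOp k g).eval q)) := by
      simp only [map_add, eval_add, mul_add, Finset.sum_add_distrib]
      ring
    rw [e]
    refine (norm_add_le _ _).trans ((add_le_add (h₁ x hx q hq) (h₂ x hx q hq)).trans ?_)
    have h1x : 1 ≤ 1 + x := by linarith
    have i1 : (1 + x) ^ d₁ ≤ (1 + x) ^ (d₁ + d₂) := pow_le_pow_right₀ h1x (by omega)
    have i2 : (1 + x) ^ d₂ ≤ (1 + x) ^ (d₁ + d₂) := pow_le_pow_right₀ h1x (by omega)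
    rw [add_mul]
    gcongr
  | monomial m c =>
    obtain ⟨C, hC, h⟩ := exists_norm_inv_pow_sub_le m N
    refine ⟨‖c‖ * C, m, by positivity, fun x hx q hq => ?_⟩
    have hr := one_sub_mem_disc hq
    have hre := re_mul_phase_nonneg hα hx
    have hinv := norm_inv_one_add_mul_le hre hr
    rw [norm_mul_phase hx] at hinv
    have h0 := h _ (1 + x) (by linarith) (one_add_mul_ne_zero hre hr) hinv
    have e : (monomial m c).eval (ratioStep α x q) - ∑ k ∈ Finset.range (N + 1),
          (x : ℂ) ^ k * (phase α ^ k * (taylorOp k (monomial m c)).eval q)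
        = c * (1 - q) ^ m * ((1 + x * phase α * (1 - q))⁻¹ ^ m
          - ∑ k ∈ Finset.range (N + 1), invPowCoeff m k * (x * phase α * (1 - q)) ^ k) := by
      rw [mul_sub, Finset.mul_sum, eval_monomial, ratioStep, div_eq_mul_inv, mul_pow]
      refine congrArg₂ (· - ·) (by ring) (Finset.sum_congr rfl fun k _ => ?_)
      rw [taylorOp_monomial]
      simp only [eval_smul, eval_mul, eval_C, eval_pow, eval_sub, eval_one, eval_X, smul_eq_mul]
      rw [mul_pow _ (1 - q), mul_pow _ (phase α), pow_add]
      ring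
    have h1q := norm_le_one_of_mem_disc hr
    have hle : ‖(x : ℂ) * phase α * (1 - q)‖ ≤ x := by
      rw [norm_mul, norm_mul_phase hx]
      exact mul_le_of_le_one_right hx h1q
    rw [e, norm_mul, norm_mul, norm_pow]
    calc ‖c‖ * ‖1 - q‖ ^ m * _
        ≤ ‖c‖ * 1 * (C * ‖(x : ℂ) * phase α * (1 - q)‖ ^ (N + 1) * (1 + x) ^ m) := by
          gcongr
          exact pow_le_one₀ (norm_nonneg _) h1q
      _ ≤ ‖c‖ * 1 * (C * x ^ (N + 1) * (1 + x) ^ m) := by gcongr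
      _ = _ := by ring

/-- A remainder of polynomial growth keeps its order in `s` after integration: the extra moments
bring factors `s ^ i ≤ 1`. -/
lemma exists_integral_pow_mul_le {p : ℝ} (hp : 0 < p) (m d : ℕ) : ∃ C : ℝ, 0 ≤ C ∧
    ∀ s : ℝ, 0 < s → s ≤ 1 →
      Integrable (fun x : ℝ => x ^ m * (1 + x) ^ d) (gammaMeasure p s⁻¹) ∧
      ∫ x, x ^ m * (1 + x) ^ d ∂gammaMeasure p s⁻¹ ≤ C * s ^ m := by
  refine ⟨∑ i ∈ Finset.range (d + 1), d.choose i * rising p (m + i),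
    Finset.sum_nonneg fun i _ => mul_nonneg (Nat.cast_nonneg _) (rising_pos hp _).le,
    fun s hs hs1 => ?_⟩
  have e : (fun x : ℝ => x ^ m * (1 + x) ^ d)
      = fun x => ∑ i ∈ Finset.range (d + 1), (d.choose i : ℝ) * x ^ (m + i) := by
    funext x
    rw [add_comm, add_pow, Finset.mul_sum]
    refine Finset.sum_congr rfl fun i _ => ?_
    rw [one_pow, pow_add]
    ring
  have hi : ∀ i ∈ Finset.range (d + 1),
      Integrable (fun x : ℝ => (d.choose i : ℝ) * x ^ (m + i)) (gammaMeasure p s⁻¹) :=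
    fun i _ => (integrable_pow_gammaMeasure hp hs _).const_mul _
  rw [e]
  refine ⟨integrable_finsetSum _ hi, ?_⟩
  rw [integral_finsetSum _ hi, Finset.sum_mul]
  refine Finset.sum_le_sum fun i _ => ?_
  rw [integral_const_mul, integral_pow_gammaMeasure hp hs, pow_add]
  have h1 : s ^ i ≤ 1 := pow_le_one₀ hs.le hs1
  have h2 := rising_pos hp (m + i)
  have h3 : s ^ m * s ^ i * rising p (m + i) ≤ rising p (m + i) * s ^ m := by
    rw [mul_comm]
    gcongr
    exact mul_le_of_le_one_right (by positivity) h1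
  have h4 := mul_le_mul_of_nonneg_left h3 (Nat.cast_nonneg (α := ℝ) (d.choose i))
  linarith

/-- Integration of a Taylor expansion against gamma measures of small scale. -/
lemma exists_norm_integral_sub_le {p : ℝ} (hp : 0 < p) (N d : ℕ) : ∃ K : ℝ, 0 ≤ K ∧
    ∀ s : ℝ, 0 < s → s ≤ 1 → ∀ (F : ℝ → ℂ) (c : ℕ → ℂ) (B : ℝ), Measurable F → 0 ≤ B →
      (∀ x, 0 ≤ x → ‖F x - ∑ k ∈ Finset.range (N + 1), (x : ℂ) ^ k * c k‖
        ≤ B * (x ^ (N + 1) * (1 + x) ^ d)) →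
      Integrable F (gammaMeasure p s⁻¹) ∧
      ‖∫ x, F x ∂gammaMeasure p s⁻¹
        - ∑ k ∈ Finset.range (N + 1), (s : ℂ) ^ k * rising p k * c k‖ ≤ B * K * s ^ (N + 1) := by
  obtain ⟨K, hK, h⟩ := exists_integral_pow_mul_le hp (N + 1) d
  refine ⟨K, hK, fun s hs hs1 F c B hF hB hbound => ?_⟩
  obtain ⟨hi, hle⟩ := h s hs hs1
  have hmono : ∀ k ∈ Finset.range (N + 1),
      Integrable (fun x : ℝ => (x : ℂ) ^ k * c k) (gammaMeasure p s⁻¹) := fun k _ => by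
    have := (integrable_pow_gammaMeasure hp hs k).ofReal (𝕜 := ℂ)
    simpa using this.mul_const (c k)
  have hpoly := integrable_finsetSum _ hmono
  have hmeas : Measurable fun x : ℝ => ∑ k ∈ Finset.range (N + 1), (x : ℂ) ^ k * c k := by
    fun_prop
  have hae : ∀ᵐ x ∂gammaMeasure p s⁻¹, ‖F x - ∑ k ∈ Finset.range (N + 1), (x : ℂ) ^ k * c k‖
        ≤ B * (x ^ (N + 1) * (1 + x) ^ d) := by
    filter_upwards [ae_nonneg_gammaMeasure p s⁻¹] with x hx using hbound x hx
  have hrem : Integrable (fun x => F x - ∑ k ∈ Finset.range (N + 1), (x : ℂ) ^ k * c k)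
      (gammaMeasure p s⁻¹) :=
    (hi.const_mul B).mono' (hF.sub hmeas).aestronglyMeasurable hae
  have hFi : Integrable F (gammaMeasure p s⁻¹) := by
    exact (hrem.add hpoly).congr (ae_of_all _ fun x => by simp)
  refine ⟨hFi, ?_⟩
  have e : ∑ k ∈ Finset.range (N + 1), (s : ℂ) ^ k * rising p k * c k
      = ∫ x, ∑ k ∈ Finset.range (N + 1), ((x : ℝ) : ℂ) ^ k * c k ∂gammaMeasure p s⁻¹ := by
    rw [integral_finsetSum _ hmono]
    refine Finset.sum_congr rfl fun k _ => ?_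
    rw [integral_mul_const]
    congr 1
    have := integral_ofReal (𝕜 := ℂ) (μ := gammaMeasure p s⁻¹) (f := fun x : ℝ => x ^ k)
    rw [integral_pow_gammaMeasure hp hs] at this
    simpa using this.symm
  rw [e, ← integral_sub hFi hpoly]
  calc _ ≤ ∫ x, B * (x ^ (N + 1) * (1 + x) ^ d) ∂gammaMeasure p s⁻¹ :=
        norm_integral_le_of_norm_le (hi.const_mul B) hae
    _ ≤ B * (K * s ^ (N + 1)) := by rw [integral_const_mul]; gcongr
    _ = _ := by ring

end

/-! ### The formal corrector equation and its solution to all orders. -/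

section
open Polynomial

/-- The coefficient of `(s e^{iα}) ^ k` in the expansion of the expectation of `f` after
one step. -/
def stepOp (p : ℝ) (k : ℕ) : ℂ[X] →ₗ[ℂ] ℂ[X] := (rising p k : ℂ) • taylorOp k

/-- The coefficient of `(s e^{iα}) ^ k` in the expansion of the mean logarithmic growth. -/
def growthCoeff (p : ℝ) (k : ℕ) : ℂ[X] :=
  C ((rising p k : ℂ) * ((-1) ^ (k + 1) / k)) * (1 - X : ℂ[X]) ^ k

/-- `φ` solves the perturbative equation of the corrector up to order `N`, with eigenvalue
expansion `c`. -/
def IsFormalCorrector (p : ℝ) (N : ℕ) (φ : ℕ → ℂ[X]) (c : ℕ → ℂ) : Prop :=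
  ∀ n ≤ N, ∑ j ∈ Finset.range (n + 1), stepOp p (n - j) (φ j) + growthCoeff p n = φ n + C (c n)

lemma eval_stepOp (p : ℝ) (k m : ℕ) (c x : ℂ) : (stepOp p k (C c * X ^ m)).eval x
    = rising p k * (c * (invPowCoeff m k * (1 - x) ^ (m + k))) := by
  rw [C_mul_X_pow_eq_monomial, stepOp, LinearMap.smul_apply, taylorOp_monomial]
  simp

lemma stepOp_zero (p : ℝ) (f : ℂ[X]) : stepOp p 0 f = f.comp (1 - X) := by
  induction f using Polynomial.induction_on' with
  | add f g hf hg => rw [map_add, hf, hg, add_comp]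
  | monomial m c =>
    refine Polynomial.funext fun x => ?_
    rw [← C_mul_X_pow_eq_monomial, eval_stepOp]
    simp [rising_zero, invPowCoeff_zero_right]

/-- At first order the point `1 - q` moves by `-β (1 - q) ^ 2`, with mean of `a` equal to `p * s`.
-/
lemma stepOp_one (p : ℝ) (f : ℂ[X]) :
    stepOp p 1 f = C (-(p : ℂ)) * (1 - X) ^ 2 * (derivative f).comp (1 - X) := by
  induction f using Polynomial.induction_on' with
  | add f g hf hg => rw [map_add, hf, hg, derivative_add, add_comp]; ring
  | monomial m c =>
    refine Polynomial.funext fun x => ?_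
    rw [← C_mul_X_pow_eq_monomial, eval_stepOp]
    rcases m with _ | m
    · simp [invPowCoeff_zero_left]
    · simp [rising, invPowCoeff]
      ring

lemma reflect_reflect (f : ℂ[X]) : (f.comp (1 - X)).comp (1 - X) = f := by
  rw [comp_assoc]
  simp

lemma exists_derivative_eq (f : ℂ[X]) : ∃ g : ℂ[X], derivative g = f := by
  induction f using Polynomial.induction_on' with
  | add f g hf hg =>
    obtain ⟨F, rfl⟩ := hf
    obtain ⟨G, rfl⟩ := hg
    exact ⟨F + G, derivative_add⟩
  | monomial m c =>
    refine ⟨monomial (m + 1) (c / (m + 1)), ?_⟩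
    rw [derivative_monomial]
    have : (m : ℂ) + 1 ≠ 0 := Nat.cast_add_one_ne_zero m
    simp [this]

lemma derivative_reflect (f : ℂ[X]) :
    derivative (f.comp (1 - X)) = -(derivative f).comp (1 - X) := by
  rw [derivative_comp]
  simp

/-- Solvability of the reflection-symmetric part of the perturbative equation. -/
lemma exists_symmetric_derivative_eq {r : ℂ[X]} (hr : r.comp (1 - X) = r) {a : ℂ} (ha : a ≠ 0) :
    ∃ (e : ℂ[X]) (c : ℂ), e.comp (1 - X) = e ∧ C a * (1 - 2 * X) * derivative e = C c - r := by
  -- The left side vanishes at `1 / 2`, which forces this value of `c`.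
  set c := r.eval (1 / 2) with hc
  have hroot : (C c - r).IsRoot (1 / 2) := by simp [hc]
  obtain ⟨h, hh⟩ := dvd_iff_isRoot.2 hroot
  have hX : (X - C (1 / 2) : ℂ[X]).comp (1 - X) = -(X - C (1 / 2)) := by
    refine Polynomial.funext fun x => ?_
    simp
    ring
  have hodd : h.comp (1 - X) = -h := by
    have h1 : (C c - r).comp (1 - X) = C c - r := by rw [sub_comp, C_comp, hr]
    rw [hh, mul_comp, hX] at h1
    have h2 : (X - C (1 / 2 : ℂ)) * (h.comp (1 - X) + h) = 0 := by linear_combination -h1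
    rcases mul_eq_zero.1 h2 with h3 | h3
    · exact absurd h3 (X_sub_C_ne_zero _)
    · exact eq_neg_of_add_eq_zero_left h3
  -- The factor `4 * a` combines `1 - 2 * X = -2 * (X - 1 / 2)` with the doubling of the derivative
  -- when `E` is symmetrised.
  obtain ⟨E, hE⟩ := exists_derivative_eq (C (-1 / (4 * a)) * h)
  refine ⟨E + E.comp (1 - X), c, ?_, ?_⟩
  · rw [add_comp, reflect_reflect, add_comm]
  · rw [derivative_add, derivative_reflect, hE, mul_comp, C_comp, hodd, hh]
    refine Polynomial.funext fun x => ?_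
    simp
    field_simp
    ring

/-- For symmetric `e`, the symmetric part of `stepOp p 1 e` is `(p / 2) * (1 - 2 * X) * e'`, so `e`
can be chosen to make the symmetric part of the order `N + 1` residual constant. The antisymmetric
part is then absorbed by the new term of order `N + 1`. -/
lemma exists_extension {p : ℝ} (hp : 0 < p) {N : ℕ} {φ : ℕ → ℂ[X]} {c : ℕ → ℂ}
    (h : IsFormalCorrector p N φ c) : ∃ (φ' : ℕ → ℂ[X]) (c' : ℕ → ℂ),
      IsFormalCorrector p (N + 1) φ' c' ∧ ∀ n ≤ N, c' n = c n := by
  set R := ∑ j ∈ Finset.range (N + 1), stepOp p (N + 1 - j) (φ j) + growthCoeff p (N + 1) with hR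
  have hsym : (C (1 / 2 : ℂ) * (R + R.comp (1 - X))).comp (1 - X)
      = C (1 / 2 : ℂ) * (R + R.comp (1 - X)) := by
    rw [mul_comp, C_comp, add_comp, reflect_reflect, add_comm]
  have hp' : (p / 2 : ℂ) ≠ 0 := div_ne_zero (by exact_mod_cast hp.ne') two_ne_zero
  obtain ⟨e, k, he, hek⟩ := exists_symmetric_derivative_eq hsym hp'
  have hde : (derivative e).comp (1 - X) = -derivative e := by
    have := derivative_reflect e
    rw [he] at this
    linear_combination this
  set S := R + stepOp p 1 e with hS
  -- For antisymmetric `f`, reflection minus identity is `-2 * f`, so `f` is half the antisymmetric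
  -- part of `S`.
  set f := C (1 / 4 : ℂ) * (S - S.comp (1 - X)) with hf
  have hstep1 : stepOp p 1 e = C (p : ℂ) * (1 - X) ^ 2 * derivative e := by
    rw [stepOp_one, hde, C_neg]
    ring
  have hfinal : S + f.comp (1 - X) = f + C k := by
    have hfc : f.comp (1 - X) = -f := by
      rw [hf, mul_comp, C_comp, sub_comp, reflect_reflect]
      ring
    have hSc : S.comp (1 - X) = R.comp (1 - X) - C (p : ℂ) * X ^ 2 * derivative e := by
      rw [hS, hstep1, add_comp, mul_comp, mul_comp, C_comp, hde]
      simp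
      ring
    rw [hfc, hf, hSc, hS, hstep1]
    refine Polynomial.funext fun x => ?_
    have h1 := congrArg (eval x) hek
    simp at h1 ⊢
    linear_combination h1
  refine ⟨fun j => φ j + (if j = N then e else 0) + (if j = N + 1 then f - φ (N + 1) else 0),
    fun n => if n = N + 1 then k else c n, ?_, ?_⟩
  · intro n hn
    beta_reduce
    rcases Nat.lt_or_ge N n with hlt | hle
    · obtain rfl : n = N + 1 := by omega
      rw [Finset.sum_range_succ, Finset.sum_range_succ, Nat.sub_self, Nat.add_sub_cancel_left,
        stepOp_zero]
      have h1 : ∑ j ∈ Finset.range N, stepOp p (N + 1 - j)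
          (φ j + (if j = N then e else 0) + (if j = N + 1 then f - φ (N + 1) else 0))
          = ∑ j ∈ Finset.range N, stepOp p (N + 1 - j) (φ j) :=
        Finset.sum_congr rfl fun j hj => by
          have := Finset.mem_range.1 hj
          rw [if_neg (by omega), if_neg (by omega), add_zero, add_zero]
      rw [h1]
      rw [Finset.sum_range_succ, Nat.add_sub_cancel_left] at hR
      simp only [Nat.succ_ne_self, Nat.left_eq_add, one_ne_zero, if_true, if_false, add_zero,
        add_sub_cancel, map_add]
      rw [← hfinal, hS, hR]
      ring
    · rcases hle.eq_or_lt with rfl | hlt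
      · rw [Finset.sum_range_succ, Nat.sub_self, stepOp_zero]
        have h1 : ∑ j ∈ Finset.range n, stepOp p (n - j)
            (φ j + (if j = n then e else 0) + (if j = n + 1 then f - φ (n + 1) else 0))
            = ∑ j ∈ Finset.range n, stepOp p (n - j) (φ j) :=
          Finset.sum_congr rfl fun j hj => by
            have := Finset.mem_range.1 hj
            rw [if_neg (by omega), if_neg (by omega), add_zero, add_zero]
        have h2 := h n le_rfl
        rw [Finset.sum_range_succ, Nat.sub_self, stepOp_zero] at h2
        rw [h1, if_pos rfl, if_neg (by omega), if_neg (by omega), add_zero, add_comp, he]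
        linear_combination h2
      · have h2 := h n hle
        rw [if_neg (by omega), if_neg (by omega), if_neg (by omega), add_zero, add_zero, ← h2]
        congr 1
        refine Finset.sum_congr rfl fun j hj => ?_
        have := Finset.mem_range.1 hj
        rw [if_neg (by omega), if_neg (by omega), add_zero, add_zero]
  · intro n hn
    simp only
    rw [if_neg (by omega)]

/-- Correctors up to fifth order. -/
def explicitCorrector (p : ℂ) : ℕ → ℂ[X]
  | 1 => C (1 / 4 * p) * X ^ 0 + C (-1 / 2 * p + 1 / 4) * X ^ 1 + C (-1 / 4) * X ^ 2
  | 2 => C (-1 / 16 * p) * X ^ 0 + C (1 / 8 * p ^ 2 - 1 / 32) * X ^ 1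
      + C (-1 / 8 * p ^ 2 + 3 / 8 * p - 5 / 32) * X ^ 2 + C (-1 / 4 * p + 3 / 8) * X ^ 3
      + C (-3 / 16) * X ^ 4
  | 3 => C (-1 / 96 * p ^ 3 + 13 / 384 * p) * X ^ 0 + C (-1 / 16 * p ^ 2 + 1 / 64) * X ^ 1
      + C (1 / 16 * p ^ 3 - 1 / 8 * p ^ 2 - 1 / 64 * p + 1 / 32) * X ^ 2
      + C (-1 / 24 * p ^ 3 + 3 / 8 * p ^ 2 - 59 / 96 * p + 7 / 32) * X ^ 3
      + C (-3 / 16 * p ^ 2 + 15 / 16 * p - 57 / 64) * X ^ 4 + C (-3 / 8 * p + 15 / 16) * X ^ 5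
      + C (-5 / 16) * X ^ 6
  | 4 => C (1 / 64 * p ^ 3 - 7 / 256 * p) * X ^ 0
      + C (-1 / 128 * p ^ 4 + 13 / 256 * p ^ 2 - 25 / 2048) * X ^ 1
      + C (-1 / 128 * p ^ 4 - 1 / 32 * p ^ 3 + 21 / 256 * p ^ 2 + 1 / 128 * p - 41 / 2048) * X ^ 2
      + C (1 / 32 * p ^ 4 - 3 / 16 * p ^ 3 + 13 / 64 * p ^ 2 + 3 / 64 * p - 27 / 512) * X ^ 3
      + C (-1 / 64 * p ^ 4 + 5 / 16 * p ^ 3 - 163 / 128 * p ^ 2 + 25 / 16 * p - 513 / 1024) * X ^ 4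
      + C (-1 / 8 * p ^ 3 + 45 / 32 * p ^ 2 - 125 / 32 * p + 375 / 128) * X ^ 5
      + C (-15 / 32 * p ^ 2 + 105 / 32 * p - 615 / 128) * X ^ 6
      + C (-15 / 16 * p + 105 / 32) * X ^ 7 + C (-105 / 128) * X ^ 8
  | 5 => C (3 / 2560 * p ^ 5 - 23 / 1024 * p ^ 3 + 1187 / 40960 * p) * X ^ 0
      + C (-1 / 256 * p ^ 5 + 13 / 512 * p ^ 3 - 25 / 4096 * p) * X ^ 2
      + C (-1 / 128 * p ^ 5 + 29 / 256 * p ^ 3 - 57 / 2048 * p) * X ^ 3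
      + C (1 / 64 * p ^ 5 + 5 / 8 * p ^ 3 - 161 / 1024 * p) * X ^ 4
      + C (-1 / 160 * p ^ 5 - 121 / 64 * p ^ 3 - 13909 / 2560 * p) * X ^ 5
      + C (105 / 64 * p ^ 3 + 4935 / 256 * p) * X ^ 6
      + C (-15 / 32 * p ^ 3 - 3225 / 128 * p) * X ^ 7 + C (945 / 64 * p) * X ^ 8
      + C (-105 / 32 * p) * X ^ 9
  | _ => 0

/-- The first five coefficients of the expansion. -/
def explicitCoeff (p : ℂ) : ℕ → ℂ
  | 1 => 1 / 2 * p
  | 2 => -1 / 8 * p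
  | 3 => -1 / 48 * p ^ 3 + 13 / 192 * p
  | 4 => 1 / 32 * p ^ 3 - 7 / 128 * p
  | 5 => 3 / 1280 * p ^ 5 - 23 / 512 * p ^ 3 + 1187 / 20480 * p
  | _ => 0

lemma isFormalCorrector_explicit (p : ℝ) :
    IsFormalCorrector p 5 (explicitCorrector p) (explicitCoeff p) := by
  intro n hn
  refine Polynomial.funext fun x => ?_
  interval_cases n <;>
  simp only [Finset.sum_range_succ, Finset.sum_range_zero, explicitCorrector, explicitCoeff,
    LinearMap.map_add, LinearMap.map_zero, eval_add, eval_stepOp, growthCoeff, eval_mul,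
    eval_C, eval_pow, eval_X,
    eval_sub, eval_one, eval_zero, Nat.reduceSub, Nat.reduceAdd] <;>
  simp only [rising, Finset.prod_range_succ, Finset.prod_range_zero, invPowCoeff, Nat.reduceAdd,
    Nat.reduceSub, Nat.choose, Nat.cast_one, Nat.cast_zero, Nat.cast_ofNat, Complex.ofReal_mul,
    Complex.ofReal_add, Complex.ofReal_one, Complex.ofReal_zero, Complex.ofReal_ofNat] <;>
  ring

/-- The formal correctors with nested eigenvalue expansions that start with the explicit one. -/
lemma exists_formalCorrector {p : ℝ} (hp : 0 < p) :
    ∃ c : ℕ → ℂ, (∀ n ≤ 5, c n = explicitCoeff p n) ∧ ∀ N, ∃ φ, IsFormalCorrector p N φ c := by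
  choose! φ' c' hext hc' using
    fun (N : ℕ) (φ : ℕ → ℂ[X]) (c : ℕ → ℂ) (h : IsFormalCorrector p N φ c) =>
      exists_extension hp h
  let A : ℕ → (ℕ → ℂ[X]) × (ℕ → ℂ) := fun k => Nat.rec (explicitCorrector p, explicitCoeff p)
    (fun k z => (φ' (5 + k) z.1 z.2, c' (5 + k) z.1 z.2)) k
  have hA : ∀ k, IsFormalCorrector p (5 + k) (A k).1 (A k).2 := by
    intro k
    induction k with
    | zero => exact isFormalCorrector_explicit p
    | succ k ih => exact hext _ _ _ ih
  have hstep : ∀ k, ∀ n ≤ 5 + k, (A (k + 1)).2 n = (A k).2 n := fun k n hn =>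
    hc' _ _ _ (hA k) n hn
  have hstable : ∀ m k, ∀ n ≤ 5 + k, (A (k + m)).2 n = (A k).2 n := by
    intro m
    induction m with
    | zero => intro k n _; rfl
    | succ m ih => intro k n hn; rw [← add_assoc, hstep _ n (by omega), ih k n hn]
  -- The polynomials change from stage to stage, but the `n`-th coefficient is stable once order `n`
  -- is reached; the diagonal gives one sequence valid for every `N`.
  refine ⟨fun n => (A n).2 n, fun n hn => ?_, fun N => ⟨(A N).1, fun n hn => ?_⟩⟩
  · have := hstable n 0 n hn
    rwa [zero_add] at this
  · have h1 := hstable (N - n) n n (by omega)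
    rw [Nat.add_sub_cancel' hn] at h1
    simp only
    rw [← h1]
    exact hA N n (by omega)

end

/-! ### The asymptotic expansion of the Lyapunov exponent. -/

section
open Polynomial

variable {α : ℝ}

lemma exists_norm_integral_eval_sub_le {p : ℝ} (hp : 0 < p) (hα : 0 ≤ (phase α).re) (N : ℕ)
    (f : ℂ[X]) : ∃ K : ℝ, 0 ≤ K ∧ ∀ s : ℝ, 0 < s → s ≤ 1 → ∀ q ∈ disc,
      Integrable (fun x => f.eval (ratioStep α x q)) (gammaMeasure p s⁻¹) ∧
      ‖∫ x, f.eval (ratioStep α x q) ∂gammaMeasure p s⁻¹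
        - ∑ k ∈ Finset.range (N + 1), (s * phase α) ^ k * (stepOp p k f).eval q‖
        ≤ K * s ^ (N + 1) := by
  obtain ⟨B, d, hB, h⟩ := exists_norm_eval_ratioStep_sub_le hα N f
  obtain ⟨K, hK, h'⟩ := exists_norm_integral_sub_le hp N d
  refine ⟨B * K, by positivity, fun s hs hs1 q hq => ?_⟩
  have hm : Measurable fun x : ℝ => f.eval (ratioStep α x q) :=
    f.continuous.measurable.comp ((measurable_ratioStep α).comp measurable_prodMk_left)
  obtain ⟨h1, h2⟩ := h' s hs hs1 _ _ B hm hB fun x hx => h x hx q hq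
  refine ⟨h1, ?_⟩
  refine (le_of_eq ?_).trans h2
  congr 2
  refine Finset.sum_congr rfl fun k _ => ?_
  rw [stepOp, LinearMap.smul_apply, eval_smul, smul_eq_mul, mul_pow]
  ring

lemma exists_norm_integral_log_sub_le {p : ℝ} (hp : 0 < p) (hα : 0 ≤ (phase α).re) (N : ℕ) :
    ∃ K : ℝ, 0 ≤ K ∧ ∀ s : ℝ, 0 < s → s ≤ 1 → ∀ q ∈ disc,
      Integrable (fun x : ℝ => Complex.log (1 + x * phase α * (1 - q))) (gammaMeasure p s⁻¹) ∧
      ‖∫ x : ℝ, Complex.log (1 + x * phase α * (1 - q)) ∂gammaMeasure p s⁻¹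
        - ∑ k ∈ Finset.range (N + 1), (s * phase α) ^ k * (growthCoeff p k).eval q‖
        ≤ K * s ^ (N + 1) := by
  obtain ⟨K, hK, h'⟩ := exists_norm_integral_sub_le hp N 1
  refine ⟨K, hK, fun s hs hs1 q hq => ?_⟩
  have hm : Measurable fun x : ℝ => Complex.log (1 + x * phase α * (1 - q)) := by fun_prop
  obtain ⟨h1, h2⟩ := h' s hs hs1 _
    -- The term `k = 0` vanishes because division by zero gives zero, in agreement with `logTaylor`
    -- and `growthCoeff`.
    (fun k => phase α ^ k * ((-1) ^ (k + 1) / k * (1 - q) ^ k)) 1 hm zero_le_one fun x hx => by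
      have h := norm_log_ratio_sub_le hα N hx hq
      rw [pow_one, one_mul]
      convert h using 3
      refine Finset.sum_congr rfl fun k _ => ?_
      rw [mul_pow, mul_pow]
      ring
  refine ⟨h1, ?_⟩
  rw [one_mul] at h2
  refine (le_of_eq ?_).trans h2
  congr 2
  refine Finset.sum_congr rfl fun k _ => ?_
  rw [growthCoeff, mul_pow]
  simp only [eval_mul, eval_C, eval_pow, eval_sub, eval_one, eval_X]
  ring

lemma sum_eq_of_isFormalCorrector {p : ℝ} {N : ℕ} {φ : ℕ → ℂ[X]} {c : ℕ → ℂ}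
    (h : IsFormalCorrector p N φ c) (t q : ℂ) :
    ∑ k ∈ Finset.range (N + 1), t ^ k * (growthCoeff p k).eval q
      + ∑ j ∈ Finset.range (N + 1), t ^ j * ∑ k ∈ Finset.range (N + 1 - j),
          t ^ k * (stepOp p k (φ j)).eval q
      = ∑ j ∈ Finset.range (N + 1), t ^ j * (φ j).eval q
        + ∑ n ∈ Finset.range (N + 1), t ^ n * c n := by
  have h1 := Finset.sum_range_diag_flip (N + 1)
    fun j k => t ^ j * (t ^ k * (stepOp p k (φ j)).eval q)
  simp only [Finset.mul_sum]
  rw [← h1, ← Finset.sum_add_distrib, ← Finset.sum_add_distrib]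
  refine Finset.sum_congr rfl fun n hn => ?_
  have h2 := congrArg (eval q) (h n (Nat.lt_succ_iff.1 (Finset.mem_range.1 hn)))
  rw [eval_add, eval_add, eval_C, eval_finsetSum] at h2
  have h3 : ∑ j ∈ Finset.range (n + 1), t ^ j * (t ^ (n - j) * (stepOp p (n - j) (φ j)).eval q)
      = t ^ n * ∑ j ∈ Finset.range (n + 1), (stepOp p (n - j) (φ j)).eval q := by
    rw [Finset.mul_sum]
    refine Finset.sum_congr rfl fun j hj => ?_
    rw [← mul_assoc, ← pow_add, Nat.add_sub_cancel' (Nat.lt_succ_iff.1 (Finset.mem_range.1 hj))]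
  rw [h3]
  linear_combination t ^ n * h2

/-- The truncated corrector `Re ∑ t ^ j φ_j` cancels all orders up to `N`. The computation stays
complex until the end, as the real part of the logarithm is the logarithm of the modulus. -/
theorem exists_abs_lyapunovExponent_sub_le {p : ℝ} (hp : 0 < p) (hα : 0 ≤ (phase α).re) {N : ℕ}
    {φ : ℕ → ℂ[X]} {c : ℕ → ℂ} (h : IsFormalCorrector p N φ c) : ∃ K : ℝ,
      ∀ s : ℝ, 0 < s → s ≤ 1 → |lyapunovExponent p s α
        - ∑ n ∈ Finset.range (N + 1), (c n * phase α ^ n).re * s ^ n| ≤ K * s ^ (N + 1) := by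
  -- Expanding `φ j` to order `N - j` suffices, since `t ^ j` supplies the other powers of `s`; the
  -- kept terms are exactly those of `sum_eq_of_isFormalCorrector`.
  choose K hK hKφ using fun j => exists_norm_integral_eval_sub_le hp hα (N - j) (φ j)
  obtain ⟨K₀, hK₀, hlog⟩ := exists_norm_integral_log_sub_le hp hα N
  refine ⟨K₀ + ∑ j ∈ Finset.range (N + 1), K j, fun s hs hs1 => ?_⟩
  set t : ℂ := s * phase α with ht
  have htn : ‖t‖ = s := norm_mul_phase hs.le
  have hΛ : ∑ n ∈ Finset.range (N + 1), (c n * phase α ^ n).re * s ^ n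
      = (∑ n ∈ Finset.range (N + 1), t ^ n * c n).re := by
    rw [Complex.re_sum]
    refine Finset.sum_congr rfl fun n _ => ?_
    rw [ht, mul_pow, ← Complex.ofReal_pow, mul_assoc, Complex.re_ofReal_mul, mul_comm (phase α ^ n),
      mul_comm]
  set P : ℂ → ℂ := fun q => ∑ j ∈ Finset.range (N + 1), t ^ j * (φ j).eval q with hP
  have hPc : Continuous P := by
    refine continuous_finsetSum _ fun j _ => continuous_const.mul (φ j).continuous
  obtain ⟨B, hB⟩ := (isCompact_closedBall (0 : ℂ) 1).exists_bound_of_continuousOn hPc.continuousOn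
  rw [hΛ]
  refine abs_lyapunovExponent_sub_le (Φ := fun q => (P q).re) (B := B) hp hs hα
    (Complex.measurable_re.comp hPc.measurable) (fun q hq => (Complex.abs_re_le_norm _).trans
      (hB q (by simpa using norm_le_one_of_mem_disc hq))) fun q hq => ?_
  have := isProbabilityMeasure_gammaMeasure hp (inv_pos.2 hs)
  obtain ⟨hli, hlb⟩ := hlog s hs hs1 q hq
  have hφi := fun j => (hKφ j s hs hs1 q hq).1
  have hφb := fun j => (hKφ j s hs hs1 q hq).2
  have hsi : ∀ j ∈ Finset.range (N + 1), Integrable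
      (fun x => t ^ j * (φ j).eval (ratioStep α x q)) (gammaMeasure p s⁻¹) :=
    fun j _ => (hφi j).const_mul _
  have hPi : Integrable (fun x => P (ratioStep α x q)) (gammaMeasure p s⁻¹) :=
    integrable_finsetSum _ hsi
  have e1 : ∫ x, increment α (fun q => (P q).re) (q, x) ∂gammaMeasure p s⁻¹
      = (∫ x : ℝ, Complex.log (1 + x * phase α * (1 - q)) ∂gammaMeasure p s⁻¹
        + ∑ j ∈ Finset.range (N + 1),
          t ^ j * ∫ x, (φ j).eval (ratioStep α x q) ∂gammaMeasure p s⁻¹ - P q).re := by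
    have e2 : ∀ x, increment α (fun q => (P q).re) (q, x)
        = (Complex.log (1 + x * phase α * (1 - q)) + P (ratioStep α x q) - P q).re := fun x => by
      simp only [increment, Complex.sub_re, Complex.add_re, Complex.log_re]
    have hi : Integrable (fun x : ℝ => Complex.log (1 + x * phase α * (1 - q))
        + P (ratioStep α x q)) (gammaMeasure p s⁻¹) := hli.add hPi
    have e3 := integral_re (𝕜 := ℂ) (hi.sub (integrable_const (P q)))
    simp only [e2]
    refine e3.trans ?_
    change Complex.re _ = _
    congr 1
    simp only [Pi.sub_apply]
    rw [integral_sub hi (integrable_const _), integral_add hli hPi, integral_finsetSum _ hsi]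
    simp only [integral_const_mul, integral_const, probReal_univ, one_smul]
  have hsum := sum_eq_of_isFormalCorrector h t q
  rw [e1, ← Complex.sub_re]
  refine (Complex.abs_re_le_norm _).trans ?_
  have e4 : (∫ x : ℝ, Complex.log (1 + x * phase α * (1 - q)) ∂gammaMeasure p s⁻¹
        + ∑ j ∈ Finset.range (N + 1),
          t ^ j * ∫ x, (φ j).eval (ratioStep α x q) ∂gammaMeasure p s⁻¹ - P q)
        - ∑ n ∈ Finset.range (N + 1), t ^ n * c n
      = (∫ x : ℝ, Complex.log (1 + x * phase α * (1 - q)) ∂gammaMeasure p s⁻¹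
          - ∑ k ∈ Finset.range (N + 1), t ^ k * (growthCoeff p k).eval q)
        + ∑ j ∈ Finset.range (N + 1), t ^ j *
          (∫ x, (φ j).eval (ratioStep α x q) ∂gammaMeasure p s⁻¹
            - ∑ k ∈ Finset.range (N + 1 - j), t ^ k * (stepOp p k (φ j)).eval q) := by
    simp only [mul_sub, Finset.sum_sub_distrib]
    linear_combination hsum
  rw [e4, add_mul, Finset.sum_mul]
  refine (norm_add_le _ _).trans (add_le_add hlb ((norm_sum_le _ _).trans
    (Finset.sum_le_sum fun j hj => ?_)))
  have hj' : N - j + 1 = N + 1 - j := by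
    have := Finset.mem_range.1 hj
    omega
  have h5 := hφb j
  rw [hj'] at h5
  rw [norm_mul, norm_pow, htn]
  calc s ^ j * _ ≤ s ^ j * (K j * s ^ (N + 1 - j)) := by gcongr
    _ = K j * (s ^ (j + (N + 1 - j))) := by rw [pow_add]; ring
    _ = K j * s ^ (N + 1) := by rw [Nat.add_sub_cancel' (Finset.mem_range.1 hj).le]

lemma hasAsymptoticSeries_of_bound {f : ℝ → ℝ} {l : ℕ → ℝ} (h0 : l 0 = 0)
    (h : ∀ N : ℕ, ∃ K : ℝ, ∀ s : ℝ, 0 < s → s ≤ 1 →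
      |f s - ∑ n ∈ Finset.range (N + 1), l n * s ^ n| ≤ K * s ^ (N + 1)) :
    HasAsymptoticSeries f l := by
  intro N
  obtain ⟨K, hK⟩ := h N
  have hO : (fun s : ℝ => f s - ∑ n ∈ Finset.Icc 1 N, l n * s ^ n)
      =O[𝓝[>] 0] fun s => s ^ (N + 1) := by
    refine IsBigO.of_bound K ?_
    filter_upwards [Ioc_mem_nhdsGT (show (0 : ℝ) < 1 from one_pos)] with s hs
    have e : ∑ n ∈ Finset.range (N + 1), l n * s ^ n = ∑ n ∈ Finset.Icc 1 N, l n * s ^ n := by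
      rw [Finset.range_eq_Ico, Finset.sum_eq_sum_Ico_succ_bot (Nat.succ_pos N), h0, zero_mul,
        zero_add]
      rfl
    rw [← e, Real.norm_eq_abs, Real.norm_of_nonneg (pow_nonneg hs.1.le _)]
    exact hK s hs.1 hs.2
  exact hO.trans_isLittleO ((isLittleO_pow_pow (Nat.lt_succ_self N)).mono nhdsWithin_le_nhds)

lemma re_ofReal_mul_phase_pow (r : ℝ) (n : ℕ) :
    ((r : ℂ) * phase α ^ n).re = r * Real.cos (n * α) := by
  rw [Complex.re_ofReal_mul, phase_pow_re]

end

end GammaProduct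

end

theorem mainTheorem7 (p α : ℝ) (hp : 0 < p) (hα : α ∈ Set.Icc (-(Real.pi / 2)) (Real.pi / 2)) :
    -- the Lyapunov exponent exists, as the limit of the means and as the almost sure limit
    (∀ s : ℝ, 0 < s →
      (∀ n : ℕ, Integrable (fun a => Real.log (GammaProduct.opNorm (GammaProduct.prodMat α a n)))
        (GammaProduct.gammaSeqLaw p s)) ∧
      Tendsto (fun n : ℕ => GammaProduct.meanLogNorm p s α n / n) atTop
        (𝓝 (GammaProduct.lyapunovExponent p s α)) ∧
      ∀ᵐ a ∂(GammaProduct.gammaSeqLaw p s),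
        Tendsto (fun n : ℕ => Real.log (GammaProduct.opNorm (GammaProduct.prodMat α a n)) / n)
          atTop (𝓝 (GammaProduct.lyapunovExponent p s α))) ∧
    -- and it has an asymptotic series as `s → 0⁺`
    ∃ l : ℕ → ℝ,
      GammaProduct.HasAsymptoticSeries (fun s => GammaProduct.lyapunovExponent p s α) l ∧
      l 1 = p * Real.cos α / 2 ∧
      l 2 = -(p * Real.cos (2 * α) / 8) ∧
      l 3 = -(p * (4 * p ^ 2 - 13) * Real.cos (3 * α) / 192) ∧
      l 4 = p * (4 * p ^ 2 - 7) * Real.cos (4 * α) / 128 ∧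
      l 5 = p * (-920 * p ^ 2 + 48 * p ^ 4 + 1187) * Real.cos (5 * α) / 20480 := by
  have hre := GammaProduct.phase_re_nonneg hα
  refine ⟨fun s hs => GammaProduct.lyapunovExponent_spec α hp hs, ?_⟩
  obtain ⟨c, hc, hcor⟩ := GammaProduct.exists_formalCorrector hp
  -- The explicit coefficients are real, so taking real parts only turns `ω ^ n` into `cos (n * α)`.
  have key : ∀ (n : ℕ) (r : ℝ), n ≤ 5 → GammaProduct.explicitCoeff p n = (r : ℂ) →
      (c n * GammaProduct.phase α ^ n).re = r * Real.cos (n * α) := fun n r hn hr => by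
    rw [hc n hn, hr, GammaProduct.re_ofReal_mul_phase_pow]
  refine ⟨fun n => (c n * GammaProduct.phase α ^ n).re,
    GammaProduct.hasAsymptoticSeries_of_bound ?_ fun N => ?_, ?_, ?_, ?_, ?_, ?_⟩
  · exact (key 0 0 (by norm_num) (by simp [GammaProduct.explicitCoeff])).trans (zero_mul _)
  · obtain ⟨φ, hφ⟩ := hcor N
    exact GammaProduct.exists_abs_lyapunovExponent_sub_le hp hre hφ
  · refine (key 1 (1 / 2 * p) (by norm_num) ?_).trans (by push_cast; ring_nf)
    simp only [GammaProduct.explicitCoeff]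
    push_cast
    ring
  · refine (key 2 (-1 / 8 * p) (by norm_num) ?_).trans (by push_cast; ring)
    simp only [GammaProduct.explicitCoeff]
    push_cast
    ring
  · refine (key 3 (-1 / 48 * p ^ 3 + 13 / 192 * p) (by norm_num) ?_).trans (by push_cast; ring)
    simp only [GammaProduct.explicitCoeff]
    push_cast
    ring
  · refine (key 4 (1 / 32 * p ^ 3 - 7 / 128 * p) (by norm_num) ?_).trans (by push_cast; ring)
    simp only [GammaProduct.explicitCoeff]
    push_cast
    ring
  · refine (key 5 (3 / 1280 * p ^ 5 - 23 / 512 * p ^ 3 + 1187 / 20480 * p) (by norm_num) ?_).trans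
      (by push_cast; ring)
    simp only [GammaProduct.explicitCoeff]
    push_cast
    ring
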